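/- **Conventions.** A *relation algebra* $\mathfrak A=(A,+,-,;,\breve{\ },1')$ is a Boolean algebra $(A,+,-)$ (with least element $0$ and greatest element $1$) with an associative operation $;$, a unary operation $\breve{\ }$ and a constant $1'$ such that $r;1'=r$, $r\breve{\ }\breve{\ }=r$, $(r;s)\breve{\ }=s\breve{\ };r\breve{\ }$, $(r+s);t=r;t+s;t$, $(r+s)\breve{\ }=r\breve{\ }+s\breve{\ }$ and $r\breve{\ };-(r;s)\le -s$. An element $f$ is *functional* if $f\breve{\ };f\le 1'$. A *measurable atom* is an atom $x\le 1'$ such that $x;1;x$ is the sum (supremum) of a set of functional elements; $I$ is the set of measurable atoms, and $\mathfrak A$ is *measurable* if $1'$ is the sum of a set of measurable atoms. For $x\in I$, $G_x$ is the set of nonzero functional elements below $x;1;x$; it is a group under $;$ and $\breve{\ }$ with identity $x$. Let $\mathcal E=\{(x,y)\in I\times I: x;1;y\ne 0\}$. For $a\le x;1;y$ put $H_a=\{f\in G_x: f;a=a\}$ and $K_a=\{g\in G_y: a;g=a\}$; $a$ is *regular* if $a;a\breve{\ }=\sum H_a$ and $a\breve{\ };a=\sum K_a$, and then $\mathrm{index}(a)=|G_x/H_a|$.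 For $(x,y)\in\mathcal E$ let $H_{xy}$ be the intersection of the groups $H_d$ over all atoms $d\le x;1;y$, and $m_{xy}=|G_x/H_{xy}|$. For a prime $p$ and $k\ge 0$ write $x\sim_k y$ if $x=y$, or $(x,y)\in\mathcal E$ and $p^k\mid m_{xy}$. **The construction for a prime $p$.** Put $a^0_{xx}=x$, and $a^0_{xy}=x;1;y$ if $x\sim_0 y$, $x\neq y$. Given the elements $a^{k-1}_{xy}$ ($k\ge1$), choose a representative $\bar x$ of each class of $\sim_k$. If $y=\bar y$, put $c_y=\bar y$; otherwise choose an atom $d\le a^{k-1}_{y\bar y}$, let $L$ be the subgroup of $G_y$ of index $p^k$, and put $c_y=\sum\{f;d: f\in L\}$. Put $a^k_{xx}=x$, and $a^k_{xy}=c_x;c_y\breve{\ }$ if $x\sim_k y$, $x\ne y$. **Properties.** A system $\langle a^k_{xy}: k\ge 0,\ x\sim_k y\rangle$ of elements is called a *$p$-system* if, whenever $x\sim_k y$ and $y\sim_k z$: (i) $a^k_{xy}$ is a regular element below $x;1;y$, and $a^0_{xy}=x;1;y$ if $x\ne y$; (ii) $a^k_{xx}=x$; (iii) $\mathrm{index}(a^k_{xy})=p^k$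 if $x\neq y$; (iv) $a^k_{yx}=(a^k_{xy})\breve{\ }$; (v) $a^k_{xz}\le a^k_{xy};a^k_{yz}$, with equality if $x\ne z$; (vi) $a^k_{xy}\le a^{k-1}_{xy}$ if $k\ge 1$. **Theorem (Scaffold Theorem).** Let $\mathfrak A$ be a measurable relation algebra in which every group $G_x$ ($x\in I$) is finite and cyclic. 1. For every $(x,y)\in\mathcal E$ there is an atom below $x;1;y$, and all atoms $d\le x;1;y$ have the same left stabilizer $H_d=H_{xy}$. 2. For every prime $p$ the construction above can be carried out, and, whatever choices of representatives and atoms are made in it, the resulting system is a $p$-system. 3. For each prime $p$ let a $p$-system be given (for instance one obtained by the construction). For $(x,y)\in\mathcal E$ let $m_{xy}=p_1^{k_1}\cdots p_n^{k_n}$ be the prime decomposition (with $1$ written as $2^0$), and let $a_{xy}=a_{xy}^{k_1}\cdot\ldots\cdot a_{xy}^{k_n}$ be the Boolean product, where $a_{xy}^{k_i}$ is taken from the $p_i$-system. Then each $a_{xy}$ is an atom, is a regular element below $x;1;y$, and has index $m_{xy}$; and $\langle a_{xy}:(x,y)\in\mathcal E\rangle$ is a scaffold: for all $(x,y),(y,z)\in\mathcal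 E$, $$a_{xx}=x,\qquad a_{yx}=a_{xy}\breve{\ },\qquad a_{xz}\le a_{xy};a_{yz}.$$ -/

import Mathlib

universe u

/-- Relation algebras in the sense of Tarski: a Boolean algebra with relative multiplication,
converse and an identity element, subject to Tarski's equations. -/
class RelationAlgebra (A : Type u) extends BooleanAlgebra A where
  comp : A → A → A
  conv : A → A
  ident : A
  comp_assoc : ∀ r s t : A, comp r (comp s t) = comp (comp r s) t
  comp_ident : ∀ r : A, comp r ident = r
  conv_conv : ∀ r : A, conv (conv r) = r
  conv_comp : ∀ r s : A, conv (comp r s) = comp (conv s) (conv r)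
  sup_comp : ∀ r s t : A, comp (r ⊔ s) t = comp r t ⊔ comp s t
  conv_sup : ∀ r s : A, conv (r ⊔ s) = conv r ⊔ conv s
  tarski : ∀ r s : A, comp (conv r) (comp r s)ᶜ ⊔ sᶜ = sᶜ

infixl:75 " ⨾ " => RelationAlgebra.comp
postfix:max "˘" => RelationAlgebra.conv

namespace RelationAlgebra

section Basic

variable {A : Type u} [RelationAlgebra A]

theorem conv_mono {a b : A} (h : a ≤ b) : a˘ ≤ b˘ := by
  have h1 := conv_sup a b
  rw [sup_eq_right.2 h] at h1
  rw [h1]; exact le_sup_left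

theorem comp_mono_left {a b : A} (c : A) (h : a ≤ b) : a ⨾ c ≤ b ⨾ c := by
  have h1 := sup_comp a b c
  rw [sup_eq_right.2 h] at h1
  rw [h1]; exact le_sup_left

theorem comp_mono_right (c : A) {a b : A} (h : a ≤ b) : c ⨾ a ≤ c ⨾ b := by
  have h1 := conv_mono (comp_mono_left (c˘) (conv_mono h))
  simpa only [conv_comp, conv_conv] using h1

theorem comp_mono {a b c d : A} (h : a ≤ b) (k : c ≤ d) : a ⨾ c ≤ b ⨾ d :=
  (comp_mono_left c h).trans (comp_mono_right b k)

theorem conv_bot : (⊥ : A)˘ = ⊥ := by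
  have h : (⊥ : A)˘ ≤ (⊥ : A)˘˘ := conv_mono bot_le
  rw [conv_conv] at h
  exact le_bot_iff.1 h

theorem conv_ident : (ident : A)˘ = ident := by
  have h : ((ident : A)˘ ⨾ ident)˘ = (ident : A)˘˘ := by rw [comp_ident]
  rw [conv_comp, conv_conv, comp_ident] at h
  exact h

theorem ident_comp (a : A) : (ident : A) ⨾ a = a := by
  have h : ((a˘ : A) ⨾ ident)˘ = a˘˘ := by rw [comp_ident]
  rwa [conv_comp, conv_conv, conv_ident] at h

/-- If `a ; b` is disjoint from `c` then `a˘ ; c` is disjoint from `b`. -/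
theorem disjoint_cycle {a b c : A} (h : Disjoint (a ⨾ b) c) : Disjoint (a˘ ⨾ c) b := by
  have h1 : c ≤ (a ⨾ b)ᶜ := le_compl_iff_disjoint_left.2 h
  have h2 : (a˘) ⨾ (a ⨾ b)ᶜ ≤ bᶜ := sup_eq_right.1 (tarski a b)
  exact le_compl_iff_disjoint_right.1 ((comp_mono_right _ h1).trans h2)

theorem comp_bot (a : A) : a ⨾ (⊥ : A) = ⊥ := by
  have h := disjoint_cycle (a := a˘) (b := ⊤) (c := ⊥) disjoint_bot_right
  rw [conv_conv] at h
  exact disjoint_top.1 h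

theorem bot_comp (a : A) : (⊥ : A) ⨾ a = ⊥ := by
  have h : ((a˘ : A) ⨾ ⊥)˘ = (⊥ : A)˘ := by rw [comp_bot]
  rwa [conv_comp, conv_conv, conv_bot] at h

/-- Distinct subidentity parts annihilate each other. -/
theorem subident_comp_le {e x : A} (he : e ≤ ident) (hx : x ≤ ident) : e ⨾ x ≤ e ⊓ x := by
  refine le_inf ?_ ?_
  · simpa only [comp_ident] using comp_mono_right e hx
  · simpa only [ident_comp] using comp_mono_left x he

theorem subident_conv_ne {x : A} (hx0 : x ≠ ⊥) : x˘ ≠ ⊥ := by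
  intro h
  apply hx0
  rw [← conv_conv x, h, conv_bot]

theorem comp_eq_of_le {x a : A} (hx : x ≤ ident) (h : a ≤ x ⨾ (⊤ : A)) : x ⨾ a = a := by
  have hsplit : x ⊔ (ident \ x) = (ident : A) := sup_sdiff_cancel_right hx
  have h0 : (ident \ x) ⨾ x = (⊥ : A) := by
    have := subident_comp_le (e := ident \ x) (x := x) sdiff_le hx
    rw [inf_comm, inf_sdiff_self_right] at this
    exact le_bot_iff.1 this
  have h1 : (ident \ x) ⨾ a = (⊥ : A) := by
    have := comp_mono_right (ident \ x) h
    rw [comp_assoc, h0, bot_comp] at this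
    exact le_bot_iff.1 this
  have h2 := sup_comp x (ident \ x) a
  rw [hsplit, ident_comp, h1, sup_bot_eq] at h2
  exact h2.symm

/-- An element is functional if `f˘ ; f ≤ 1'`. -/
def IsFunctional (f : A) : Prop := f˘ ⨾ f ≤ ident

/-- A subidentity atom `x` is measurable if `x ; 1 ; x` is the sum of functional elements. -/
def IsMeasurableAtom (x : A) : Prop :=
  IsAtom x ∧ x ≤ ident ∧
    ∃ S : Set A, (∀ f ∈ S, IsFunctional f) ∧ IsLUB S (x ⨾ ⊤ ⨾ x)

variable (A) in
/-- A relation algebra is measurable if its identity is the sum of measurable atoms. -/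
def IsMeasurable : Prop :=
  ∃ S : Set A, (∀ x ∈ S, IsMeasurableAtom x) ∧ IsLUB S (ident : A)

variable (A) in
/-- The set `I` of measurable atoms, as a type. -/
abbrev MeasurableAtom : Type u := {x : A // IsMeasurableAtom x}

/-- The rectangle `x ; 1 ; y`. -/
def rect (x y : MeasurableAtom A) : A := (x : A) ⨾ ⊤ ⨾ (y : A)

theorem subident_conv {x : A} (hx : IsAtom x) (h : x ≤ ident) : x˘ = x := by
  have h1 : x˘ ≤ ident := by simpa only [conv_ident] using conv_mono h
  have h2 : x ⊓ x˘ ≠ ⊥ := by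
    intro h0
    have hd : Disjoint (x˘ ⨾ x) ident := by
      have := subident_comp_le h1 h
      rw [inf_comm, h0] at this
      rw [le_bot_iff.1 this]; exact disjoint_bot_left
    have := disjoint_cycle hd
    rw [conv_conv, comp_ident, disjoint_self] at this
    exact hx.1 this
  have h3 : x ≤ x˘ := by
    rcases hx.le_iff.1 (inf_le_left : x ⊓ x˘ ≤ x) with h4 | h4
    · exact absurd h4 h2
    · exact inf_eq_left.1 h4
  refine le_antisymm ?_ h3
  simpa only [conv_conv] using conv_mono h3

namespace MeasurableAtom

variable (x y : MeasurableAtom A)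

theorem conv_eq : (x : A)˘ = x := subident_conv x.2.1 x.2.2.1

theorem rect_conv : (rect x y)˘ = rect y x := by
  have ht : (⊤ : A)˘ = ⊤ := by
    apply top_le_iff.1
    have h : ((⊤ : A)˘)˘ ≤ (⊤ : A)˘ := conv_mono le_top
    rwa [conv_conv] at h
  simp only [rect, conv_comp, conv_eq, ht, comp_assoc]

variable {x y}

theorem comp_of_le_rect {a : A} (h : a ≤ rect x y) : (x : A) ⨾ a = a := by
  refine comp_eq_of_le x.2.2.1 (h.trans ?_)
  rw [rect, ← comp_assoc]
  exact comp_mono_right _ le_top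

theorem of_le_rect_comp {a : A} (h : a ≤ rect x y) : a ⨾ (y : A) = a := by
  have h1 : a˘ ≤ rect y x := by
    have := conv_mono h
    rwa [rect_conv] at this
  have h2 := congrArg conv (comp_of_le_rect h1)
  rwa [conv_comp, conv_conv, conv_eq] at h2

theorem ident_le_rect : (x : A) ≤ rect x x := by
  have h : (x : A) ⨾ ident ⨾ (x : A) ≤ rect x x := comp_mono_left _ (comp_mono_right _ le_top)
  rw [comp_ident] at h
  have h1 : (x : A) ⨾ (x : A) = x := by
    refine comp_eq_of_le x.2.2.1 ?_
    simpa only [comp_ident] using comp_mono_right (x : A) (le_top : (ident : A) ≤ ⊤)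
  rwa [h1] at h

theorem comp_le_rect {z : MeasurableAtom A} {a b : A} (ha : a ≤ rect x y) (hb : b ≤ rect y z) :
    a ⨾ b ≤ rect x z := by
  have h := comp_mono ha hb
  refine h.trans ?_
  have e : rect x y ⨾ rect y z = (x : A) ⨾ (⊤ ⨾ (y : A) ⨾ (y : A) ⨾ ⊤) ⨾ (z : A) := by
    simp only [rect, comp_assoc]
  rw [e]
  exact comp_mono_left _ (comp_mono_right _ le_top)

/-- A nonzero subidentity element below `x ; 1 ; x` is `x`. -/
theorem eq_of_subident {e : A} (h1 : e ≤ ident) (h2 : e ≤ rect x x) (h0 : e ≠ ⊥) : e = x := by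
  have h3 : (x : A) ⨾ e = e := comp_of_le_rect h2
  have h4 : e ≤ (x : A) := by
    rw [← h3]
    exact (subident_comp_le x.2.2.1 h1).trans inf_le_left
  exact (x.2.1.le_iff.1 h4).resolve_left h0

theorem comp_conv_inf_ident {h : A} (h0 : h ≠ ⊥) : (h˘ ⨾ h) ⊓ ident ≠ ⊥ := by
  intro hb
  have hd : Disjoint (h˘ ⨾ h) ident := disjoint_iff.2 hb
  have := disjoint_cycle hd
  rw [conv_conv, comp_ident, disjoint_self] at this
  exact h0 this

theorem le_comp_conv {h : A} (h0 : h ≠ ⊥) (hle : h ≤ rect x x) : (x : A) ≤ h˘ ⨾ h := by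
  have h1 : h˘ ≤ rect x x := by
    have := conv_mono hle
    rwa [rect_conv] at this
  have := eq_of_subident (x := x) (inf_le_right : (h˘ ⨾ h) ⊓ ident ≤ ident)
    (inf_le_left.trans (comp_le_rect h1 hle)) (comp_conv_inf_ident h0)
  rw [← this]; exact inf_le_left

theorem functional_conv_comp {f : A} (h0 : f ≠ ⊥) (hf : IsFunctional f) (hle : f ≤ rect x x) :
    f˘ ⨾ f = x := by
  have h1 : f˘ ≤ rect x x := by
    have := conv_mono hle
    rwa [rect_conv] at this
  refine eq_of_subident hf (comp_le_rect h1 hle) ?_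
  intro hb
  have := le_comp_conv h0 hle
  rw [hb] at this
  exact x.2.1.1 (le_bot_iff.1 this)

theorem functional_conv {f : A} (h0 : f ≠ ⊥) (hf : IsFunctional f) (hle : f ≤ rect x x) :
    IsFunctional (f˘) := by
  obtain ⟨S, hS, hlub⟩ := x.2.2.2
  have hc0 : f˘ ≠ ⊥ := subident_conv_ne h0
  have h1 : f˘ ≤ rect x x := by
    have := conv_mono hle
    rwa [rect_conv] at this
  -- some member of `S` meets `f˘`
  have hex : ∃ g ∈ S, g ⊓ f˘ ≠ ⊥ := by
    by_contra hcon
    push Not at hcon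
    have hub : (x : A) ⨾ ⊤ ⨾ (x : A) ≤ (f˘)ᶜ :=
      hlub.2 fun g hg => le_compl_iff_disjoint_right.2 (disjoint_iff.2 (hcon g hg))
    have h2 : f˘ ≤ (f˘)ᶜ := h1.trans hub
    exact hc0 (disjoint_self.1 (le_compl_iff_disjoint_right.1 h2))
  obtain ⟨g, hg, hne⟩ := hex
  have hfun : IsFunctional (g ⊓ f˘) :=
    (comp_mono (conv_mono inf_le_left) inf_le_left).trans (hS g hg)
  set h : A := g ⊓ f˘ with hdef
  have hle2 : h˘ ≤ f := by
    have := conv_mono (inf_le_right : g ⊓ f˘ ≤ f˘)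
    rwa [conv_conv] at this
  have hx : (x : A) ≤ h˘ ⨾ h := le_comp_conv hne (inf_le_right.trans h1)
  have hfh : f ≤ h˘ := by
    calc f = (x : A) ⨾ f := (comp_of_le_rect hle).symm
      _ ≤ h˘ ⨾ h ⨾ f := comp_mono_left _ hx
      _ = h˘ ⨾ (h ⨾ f) := (comp_assoc _ _ _).symm
      _ ≤ h˘ ⨾ (f˘ ⨾ f) := comp_mono_right _ (comp_mono_left _ inf_le_right)
      _ ≤ h˘ ⨾ ident := comp_mono_right _ hf
      _ = h˘ := comp_ident _
  have : f = h˘ := le_antisymm hfh hle2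
  rw [this, conv_conv]
  exact hfun

end MeasurableAtom

open MeasurableAtom

/-- The carrier of `G_x`: the nonzero functional elements below `x ; 1 ; x`. -/
def G (x : MeasurableAtom A) : Type u := {f : A // f ≠ ⊥ ∧ IsFunctional f ∧ f ≤ rect x x}

/-- `G_x` is a group under relative multiplication and converse, with identity `x`. -/
instance (x : MeasurableAtom A) : Group (G x) where
  mul f g := ⟨f.1 ⨾ g.1, by
    obtain ⟨f, f0, ff, fl⟩ := f
    obtain ⟨g, g0, gf, gl⟩ := g
    refine ⟨fun h => g0 ?_, ?_, comp_le_rect fl gl⟩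
    · have h1 : f˘ ⨾ (f ⨾ g) = f˘ ⨾ ⊥ := congrArg _ h
      rw [comp_assoc, functional_conv_comp f0 ff fl, comp_of_le_rect gl, comp_bot] at h1
      exact h1
    · change (f ⨾ g)˘ ⨾ (f ⨾ g) ≤ ident
      rw [conv_comp, comp_assoc, ← comp_assoc (g˘) (f˘) f, functional_conv_comp f0 ff fl,
        ← comp_assoc, comp_of_le_rect gl]
      exact gf⟩
  one := ⟨x, x.2.1.1, by
    change (x : A)˘ ⨾ (x : A) ≤ ident
    rw [conv_eq, comp_of_le_rect ident_le_rect]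
    exact x.2.2.1, ident_le_rect⟩
  inv f := ⟨f.1˘, subident_conv_ne f.2.1, functional_conv f.2.1 f.2.2.1 f.2.2.2, by
    have := conv_mono f.2.2.2
    rwa [rect_conv] at this⟩
  mul_assoc f g h := Subtype.ext (comp_assoc f.1 g.1 h.1).symm
  one_mul f := Subtype.ext (comp_of_le_rect f.2.2.2)
  mul_one f := Subtype.ext (of_le_rect_comp f.2.2.2)
  inv_mul_cancel f := Subtype.ext (functional_conv_comp f.2.1 f.2.2.1 f.2.2.2)

theorem G.val_mul {x : MeasurableAtom A} (f g : G x) : (f * g).1 = f.1 ⨾ g.1 := rfl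
theorem G.val_one {x : MeasurableAtom A} : (1 : G x).1 = x := rfl
theorem G.val_inv {x : MeasurableAtom A} (f : G x) : (f⁻¹).1 = f.1˘ := rfl

/-- The left stabilizer `H_a = {f ∈ G_x : f ; a = a}` of an element `a ≤ x ; 1 ; y`
(see `mem_leftStab`). It is written with `x ; a`, which is `a` for such `a`, so that it is a
subgroup for every `a`. -/
def leftStab (x : MeasurableAtom A) (a : A) : Subgroup (G x) where
  carrier := {f | f.1 ⨾ ((x : A) ⨾ a) = (x : A) ⨾ a}
  one_mem' := by
    change (x : A) ⨾ ((x : A) ⨾ a) = (x : A) ⨾ a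
    rw [comp_assoc, comp_of_le_rect ident_le_rect]
  mul_mem' := by
    intro f g hf hg
    change (f.1 ⨾ g.1) ⨾ ((x : A) ⨾ a) = (x : A) ⨾ a
    rw [← comp_assoc, hg, hf]
  inv_mem' := by
    intro f hf
    change f.1˘ ⨾ ((x : A) ⨾ a) = (x : A) ⨾ a
    have h : f.1 ⨾ ((x : A) ⨾ a) = (x : A) ⨾ a := hf
    calc f.1˘ ⨾ ((x : A) ⨾ a) = f.1˘ ⨾ (f.1 ⨾ ((x : A) ⨾ a)) := by rw [h]
      _ = (x : A) ⨾ a := by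
        rw [comp_assoc, functional_conv_comp f.2.1 f.2.2.1 f.2.2.2, comp_assoc,
          comp_of_le_rect ident_le_rect]

theorem mem_leftStab {x y : MeasurableAtom A} {a : A} (h : a ≤ rect x y) (f : G x) :
    f ∈ leftStab x a ↔ f.1 ⨾ a = a := by
  change f.1 ⨾ ((x : A) ⨾ a) = (x : A) ⨾ a ↔ _
  rw [comp_of_le_rect h]

/-- The right stabilizer `K_a = {g ∈ G_y : a ; g = a}` of an element `a ≤ x ; 1 ; y`
(see `mem_rightStab`). -/
def rightStab (y : MeasurableAtom A) (a : A) : Subgroup (G y) where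
  carrier := {g | a ⨾ (y : A) ⨾ g.1 = a ⨾ (y : A)}
  one_mem' := by
    change a ⨾ (y : A) ⨾ (y : A) = a ⨾ (y : A)
    rw [← comp_assoc, comp_of_le_rect ident_le_rect]
  mul_mem' := by
    intro f g hf hg
    change a ⨾ (y : A) ⨾ (f.1 ⨾ g.1) = a ⨾ (y : A)
    rw [comp_assoc, hf, hg]
  inv_mem' := by
    intro f hf
    change a ⨾ (y : A) ⨾ (f⁻¹).1 = a ⨾ (y : A)
    have h : a ⨾ (y : A) ⨾ f.1 = a ⨾ (y : A) := hf
    calc a ⨾ (y : A) ⨾ (f⁻¹).1 = a ⨾ (y : A) ⨾ f.1 ⨾ (f⁻¹).1 := by rw [h]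
      _ = a ⨾ (y : A) := by
        rw [← comp_assoc, ← G.val_mul, mul_inv_cancel, G.val_one, ← comp_assoc,
          comp_of_le_rect ident_le_rect]

theorem mem_rightStab {x y : MeasurableAtom A} {a : A} (h : a ≤ rect x y) (g : G y) :
    g ∈ rightStab y a ↔ a ⨾ g.1 = a := by
  change a ⨾ (y : A) ⨾ g.1 = a ⨾ (y : A) ↔ _
  rw [of_le_rect_comp h]

/-- `a ≤ x ; 1 ; y` is regular if `a ; a˘` is the sum of the left stabilizer of `a` and
`a˘ ; a` is the sum of the right stabilizer of `a`. -/
def IsRegular (x y : MeasurableAtom A) (a : A) : Prop :=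
  a ≤ rect x y ∧
    IsLUB {e : A | ∃ f ∈ leftStab x a, e = f.1} (a ⨾ a˘) ∧
    IsLUB {e : A | ∃ g ∈ rightStab y a, e = g.1} (a˘ ⨾ a)

/-- The index `|G_x / H_a|` of an element `a ≤ x ; 1 ; y`. -/
noncomputable def index (x : MeasurableAtom A) (a : A) : ℕ := (leftStab x a).index

/-- The relation `ℰ`: pairs of measurable atoms with `x ; 1 ; y ≠ 0`. -/
def E (x y : MeasurableAtom A) : Prop := rect x y ≠ ⊥

/-- `H_xy`: the common left stabilizer of the atoms below `x ; 1 ; y`. -/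
def H (x y : MeasurableAtom A) : Subgroup (G x) :=
  ⨅ d ∈ {d : A | IsAtom d ∧ d ≤ rect x y}, leftStab x d

/-- `m_xy = |G_x / H_xy|`. -/
noncomputable def m (x y : MeasurableAtom A) : ℕ := (H x y).index

/-- The relation `x ∼_k y` for the prime `p`. -/
def Sim (p k : ℕ) (x y : MeasurableAtom A) : Prop := x = y ∨ (E x y ∧ p ^ k ∣ m x y)

/-- One step of the construction for the prime `p`: from the elements `prev x y` of level `k - 1`
to the elements `next x y` of level `k`. Here `r x` is the chosen representative of the class of
`x` under `∼_k`, and `c y` is the element `c_{y, r y}`; it is `r y` if `y = r y`, and otherwise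
the sum of all `f ; d` with `f ∈ L`, where `d` is a chosen atom below `prev y (r y)` and `L` is
the subgroup of index `p ^ k` in `G_y`. -/
def IsStep (p k : ℕ) (prev next : MeasurableAtom A → MeasurableAtom A → A) : Prop :=
  ∃ (r : MeasurableAtom A → MeasurableAtom A) (c : MeasurableAtom A → A),
    (∀ x, Sim p k x (r x)) ∧
    (∀ x y, Sim p k x y → r x = r y) ∧
    (∀ y, y = r y → c y = r y) ∧
    (∀ y, y ≠ r y → ∃ (d : A) (L : Subgroup (G y)), IsAtom d ∧ d ≤ prev y (r y) ∧
      L.index = p ^ k ∧ IsLUB {e : A | ∃ f ∈ L, e = f.1 ⨾ d} (c y)) ∧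
    (∀ x, next x x = x) ∧
    (∀ x y, Sim p k x y → x ≠ y → next x y = c x ⨾ (c y)˘)

/-- The system `a k x y` (relevant for `x ∼_k y`) arises from the construction for the prime `p`,
for some choices of representatives and of atoms. -/
def IsConstructed (p : ℕ) (a : ℕ → MeasurableAtom A → MeasurableAtom A → A) : Prop :=
  (∀ x, a 0 x x = x) ∧
  (∀ x y, Sim p 0 x y → x ≠ y → a 0 x y = rect x y) ∧
  ∀ k, IsStep p (k + 1) (a k) (a (k + 1))

/-- The six properties of the systems constructed for the prime `p`. -/
structure IsPrimeSystem (p : ℕ) (a : ℕ → MeasurableAtom A → MeasurableAtom A → A) : Prop where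
  regular : ∀ k x y, Sim p k x y → IsRegular x y (a k x y)
  zero : ∀ x y, Sim p 0 x y → x ≠ y → a 0 x y = rect x y
  diag : ∀ k x, a k x x = x
  index_eq : ∀ k x y, Sim p k x y → x ≠ y → index x (a k x y) = p ^ k
  conv_eq : ∀ k x y, Sim p k x y → a k y x = (a k x y)˘
  le_comp : ∀ k x y z, Sim p k x y → Sim p k y z → a k x z ≤ a k x y ⨾ a k y z
  eq_comp : ∀ k x y z, Sim p k x y → Sim p k y z → x ≠ z → a k x z = a k x y ⨾ a k y z
  antitone : ∀ k x y, Sim p (k + 1) x y → a (k + 1) x y ≤ a k x y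

/-- The primes of the decomposition of `n`, where `1` is written as `2 ^ 0`. -/
def primesOf (n : ℕ) : Finset ℕ := if n = 1 then {2} else n.primeFactors

/-- `a_xy`: the Boolean product over the prime decomposition `∏ p ^ k` of `m_xy` of the elements
`a p k x y`. -/
noncomputable def scaffoldElt (a : ℕ → ℕ → MeasurableAtom A → MeasurableAtom A → A)
    (x y : MeasurableAtom A) : A :=
  (primesOf (m x y)).inf fun p => a p ((m x y).factorization p) x y

/-- A scaffold: a system of atoms `a x y`, for pairs in `ℰ`, with the three scaffold conditions. -/
structure IsScaffold (a : MeasurableAtom A → MeasurableAtom A → A) : Prop where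
  atom : ∀ x y, E x y → IsAtom (a x y)
  diag : ∀ x, a x x = x
  conv_eq : ∀ x y, E x y → a y x = (a x y)˘
  le_comp : ∀ x y z, E x y → E y z → a x z ≤ a x y ⨾ a y z

end Basic

end RelationAlgebra

/-! Relative multiplication makes `G x` act on the elements below `x ; 1 ; y`. The elements of `G x`
are atoms whose sum is `x ; 1 ; x`. Hence for finite `G x` there are atoms below every nonzero
element of `x ; 1 ; y`, and the action permutes the atoms below `x ; 1 ; y` transitively. As `G x`
is commutative, these atoms share one stabilizer, and left multiplication by an element of `G x`
agrees on `x ; 1 ; y` with right multiplication by an element of `G y` (`exists_comp_right_eq`).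
Consequently the regular elements are exactly the blocks of imprimitivity (`isRegular_iff`), and
converses and products of blocks are blocks.

In a finite cyclic group a subgroup is determined by its index, and inclusion is reverse
divisibility of indices. So two blocks that meet are compared by their indices alone
(`IsBlock.le_of_leftStab_le`), and a block below `x ; 1 ; y` of index `m x y` is an atom.

In the construction, `c x` and `c y` end at the same representative, where their stabilizers are
comparable. Then `c x ; (c y)˘` keeps the index of the factor that does not start at the
representative, and the inner factor of `c x ; (c y)˘ ; c y ; (c z)˘` is absorbed on one side
(`IsStep.isLevel`).

For the scaffold, blocks of coprime indices meet in a block whose index is the product, so `a_xy`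
has index `m x y`. To compare `a_xz` with `a_xy ; a_yz`, let `n` be the index of the latter. It
divides all three of `m x y`, `m y z`, `m x z`, so the p-systems compose at the levels given by the
prime powers in `n`. The product of their elements at `(x, z)` is a block of index `n` that contains
both `a_xz` and `a_xy ; a_yz`; equality of indices identifies it with the latter. -/

/-! ### Subgroups of finite cyclic groups and their indices. -/

theorem subgroup_le_iff_index_dvd {C : Type*} [Group C] [IsCyclic C] [Finite C]
    {K N : Subgroup C} : K ≤ N ↔ N.index ∣ K.index := by
  classical
  refine ⟨Subgroup.index_dvd_of_le, fun h => ?_⟩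
  have hdvd : Nat.card K ∣ Nat.card N := by
    obtain ⟨t, ht⟩ := h
    have h1 := N.card_mul_index
    rw [← K.card_mul_index, ht, mul_left_comm, mul_comm (Nat.card N)] at h1
    exact ⟨t, Nat.eq_of_mul_eq_mul_left (Nat.pos_of_ne_zero N.index_ne_zero_of_finite) h1⟩
  intro g hg
  have hg1 : g ^ Nat.card N = 1 := by
    obtain ⟨t, ht⟩ := hdvd
    have h2 : (⟨g, hg⟩ : K) ^ Nat.card K = 1 := pow_card_eq_one'
    have h3 : g ^ Nat.card K = 1 := congrArg Subtype.val h2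
    rw [ht, pow_mul, h3, one_pow]
  have := Fintype.ofFinite C
  -- A cyclic group has at most `Nat.card N` solutions of `c ^ Nat.card N = 1`, so `N` is the full
  -- solution set, and `g` is a solution.
  have hsub : (Finset.univ.filter fun c : C => c ∈ N) ⊆
      Finset.univ.filter fun c : C => c ^ Nat.card N = 1 := by
    intro c hc
    have hc' : c ∈ N := (Finset.mem_filter.1 hc).2
    have h2 : (⟨c, hc'⟩ : N) ^ Nat.card N = 1 := pow_card_eq_one'
    exact Finset.mem_filter.2 ⟨Finset.mem_univ _, congrArg Subtype.val h2⟩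
  have hcard : (Finset.univ.filter fun c : C => c ^ Nat.card N = 1).card ≤
      (Finset.univ.filter fun c : C => c ∈ N).card := by
    refine (IsCyclic.card_pow_eq_one_le Nat.card_pos).trans (le_of_eq ?_)
    rw [Nat.card_eq_fintype_card]
    exact Fintype.card_subtype _
  have : g ∈ Finset.univ.filter fun c : C => c ∈ N := by
    rw [Finset.eq_of_subset_of_card_le hsub hcard]
    simpa using hg1
  simpa using this

theorem exists_subgroup_index_eq {C : Type*} [Group C] [IsCyclic C] [Finite C] {n : ℕ}
    (h : n ∣ Nat.card C) : ∃ L : Subgroup C, L.index = n := by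
  let _ : CommGroup C := IsCyclic.commGroup
  refine ⟨(powMonoidHom n : C →* C).range, ?_⟩
  rw [IsCyclic.index_powMonoidHom_range, Nat.gcd_eq_right h]

/-- Subgroups of coprime indices factor the whole cyclic group. -/
theorem exists_mul_of_index_coprime {C : Type*} [Group C] [IsCyclic C] {K N : Subgroup C}
    (h : K.index.Coprime N.index) (g : C) : ∃ k ∈ K, ∃ n ∈ N, k * n = g := by
  let _ : CommGroup C := IsCyclic.commGroup
  have h1 : K ⊔ N = ⊤ := Subgroup.index_eq_one.1 (Nat.eq_one_of_dvd_coprimes h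
    (Subgroup.index_dvd_of_le le_sup_left) (Subgroup.index_dvd_of_le le_sup_right))
  exact Subgroup.mem_sup.1 (h1 ▸ Subgroup.mem_top g)

theorem index_inf_of_coprime {C : Type*} [Group C] [Finite C] {K N : Subgroup C}
    (h : K.index.Coprime N.index) : (K ⊓ N).index = K.index * N.index :=
  le_antisymm Subgroup.index_inf_le (Nat.le_of_dvd (Nat.pos_of_ne_zero
    (Subgroup.index_ne_zero_of_finite)) (h.mul_dvd_of_dvd_of_dvd
      (Subgroup.index_dvd_of_le inf_le_left) (Subgroup.index_dvd_of_le inf_le_right)))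

/-- A map constant exactly on the left cosets of `N` takes `N.index` values. -/
theorem card_range_eq_index {C X : Type*} [Group C] (N : Subgroup C) (F : C → X)
    (h : ∀ g g', F g = F g' ↔ g⁻¹ * g' ∈ N) : Nat.card (Set.range F) = N.index := by
  symm
  refine Nat.card_congr (Equiv.ofBijective
    (Quotient.lift (fun g => (⟨F g, g, rfl⟩ : Set.range F)) ?_) ⟨?_, ?_⟩)
  · intro g g' hg
    exact Subtype.ext ((h g g').2 (QuotientGroup.leftRel_apply.1 hg))
  · rintro ⟨g⟩ ⟨g'⟩ hg
    exact Quotient.sound (QuotientGroup.leftRel_apply.2 ((h g g').1 (congrArg Subtype.val hg)))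
  · rintro ⟨_, g, rfl⟩
    exact ⟨Quotient.mk _ g, rfl⟩

namespace RelationAlgebra

open MeasurableAtom

/-! ### Converse as a symmetry, and the cycle laws. -/

section Converse

variable {A : Type u} [RelationAlgebra A]

/-- Converse as an order automorphism. -/
def convIso : A ≃o A where
  toFun := conv
  invFun := conv
  left_inv := conv_conv
  right_inv := conv_conv
  map_rel_iff' {a b} := by
    refine ⟨fun h => ?_, conv_mono⟩
    simpa only [Equiv.coe_fn_mk, conv_conv] using conv_mono h

theorem disjoint_conv {a b : A} : Disjoint (a˘) (b˘) ↔ Disjoint a b :=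
  disjoint_map_orderIso_iff convIso

theorem isAtom_conv {a : A} : IsAtom (a˘) ↔ IsAtom a := convIso.isAtom_iff a

theorem finset_inf_conv {ι : Type*} (s : Finset ι) (f : ι → A) :
    (s.inf f)˘ = s.inf fun i => (f i)˘ := map_finset_inf convIso s f

theorem disjoint_comp_iff_left {a b c : A} : Disjoint (a ⨾ b) c ↔ Disjoint b (a˘ ⨾ c) := by
  refine ⟨fun h => (disjoint_cycle h).symm, fun h => ?_⟩
  have := disjoint_cycle h.symm
  rwa [conv_conv] at this

theorem disjoint_comp_iff_right {a b c : A} : Disjoint (a ⨾ b) c ↔ Disjoint a (c ⨾ b˘) := by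
  rw [← disjoint_conv, conv_comp, disjoint_comp_iff_left, ← disjoint_conv]
  simp only [conv_comp, conv_conv]

end Converse

/-! ### The action of `G x` on the elements below `x ; 1 ; y`, and its atoms. -/

section Action

variable {A : Type u} [RelationAlgebra A] {x y z : MeasurableAtom A} {a b c d e : A}

theorem conv_le_rect (h : a ≤ rect x y) : a˘ ≤ rect y x := by
  rw [← rect_conv]; exact conv_mono h

theorem le_conv_comp (h0 : a ≠ ⊥) (h : a ≤ rect x y) : (y : A) ≤ a˘ ⨾ a := by
  rw [← eq_of_subident (x := y) (inf_le_right : (a˘ ⨾ a) ⊓ ident ≤ ident)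
    (inf_le_left.trans (comp_le_rect (conv_le_rect h) h)) (comp_conv_inf_ident h0)]
  exact inf_le_left

theorem le_comp_conv_self (h0 : a ≠ ⊥) (h : a ≤ rect x y) : (x : A) ≤ a ⨾ a˘ := by
  simpa only [conv_conv] using le_conv_comp (subident_conv_ne h0) (conv_le_rect h)

theorem comp_ne_bot (ha0 : a ≠ ⊥) (ha : a ≤ rect x y) (hb0 : b ≠ ⊥) (hb : b ≤ rect y z) :
    a ⨾ b ≠ ⊥ := by
  intro h
  have h1 := comp_mono_left b (le_conv_comp ha0 ha)
  rw [comp_of_le_rect hb, ← comp_assoc, h, comp_bot] at h1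
  exact hb0 (le_bot_iff.1 h1)

theorem G.comp_le (f : G x) (ha : a ≤ rect x y) : f.1 ⨾ a ≤ rect x y :=
  comp_le_rect f.2.2.2 ha

theorem G.le_comp (g : G y) (ha : a ≤ rect x y) : a ⨾ g.1 ≤ rect x y :=
  comp_le_rect ha g.2.2.2

theorem G.mul_comp (f g : G x) (a : A) : (f * g).1 ⨾ a = f.1 ⨾ (g.1 ⨾ a) :=
  (comp_assoc _ _ _).symm

theorem G.comp_mul (f g : G y) (a : A) : a ⨾ (f * g).1 = a ⨾ f.1 ⨾ g.1 :=
  comp_assoc _ _ _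

theorem G.one_comp (ha : a ≤ rect x y) : (1 : G x).1 ⨾ a = a := comp_of_le_rect ha

theorem G.comp_one (ha : a ≤ rect x y) : a ⨾ (1 : G y).1 = a := of_le_rect_comp ha

theorem G.inv_comp_comp (f : G x) (ha : a ≤ rect x y) : (f⁻¹).1 ⨾ (f.1 ⨾ a) = a := by
  rw [← G.mul_comp, inv_mul_cancel, G.one_comp ha]

theorem G.comp_inv_comp (f : G x) (ha : a ≤ rect x y) : f.1 ⨾ ((f⁻¹).1 ⨾ a) = a := by
  rw [← G.mul_comp, mul_inv_cancel, G.one_comp ha]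

theorem G.comp_comp_inv (g : G y) (ha : a ≤ rect x y) : a ⨾ g.1 ⨾ (g⁻¹).1 = a := by
  rw [← G.comp_mul, mul_inv_cancel, G.comp_one ha]

theorem G.conv_comp_inv (f : G x) (a : A) : (f.1 ⨾ a)˘ = a˘ ⨾ (f⁻¹).1 := conv_comp _ _

theorem G.disjoint_comp (f : G x) (a b : A) :
    Disjoint (f.1 ⨾ a) b ↔ Disjoint a ((f⁻¹).1 ⨾ b) := disjoint_comp_iff_left

/-- Multiplication by `f` is monotone on the elements below `x ; 1 ; y`, with monotone inverse given
by `f⁻¹`. -/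
theorem G.isAtom_comp (f : G x) (hd : IsAtom d) (hl : d ≤ rect x y) : IsAtom (f.1 ⨾ d) := by
  refine ⟨comp_ne_bot f.2.1 f.2.2.2 hd.1 hl, fun b hb => ?_⟩
  have hbl : b ≤ rect x y := hb.le.trans (f.comp_le hl)
  have h1 : (f⁻¹).1 ⨾ b ≤ d := by
    have := comp_mono_right (f⁻¹).1 hb.le
    rwa [f.inv_comp_comp hl] at this
  rcases hd.le_iff.1 h1 with h | h
  · rw [← f.comp_inv_comp hbl, h, comp_bot]
  · rw [← h, f.comp_inv_comp hbl] at hb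
    exact absurd hb (lt_irrefl _)

theorem G.isAtom_comp_right (g : G y) (hd : IsAtom d) (hl : d ≤ rect x y) :
    IsAtom (d ⨾ g.1) := by
  have := isAtom_conv.2 ((g⁻¹).isAtom_comp (isAtom_conv.2 hd) (conv_le_rect hl))
  rwa [G.conv_comp_inv, inv_inv, conv_conv] at this

theorem G.isAtom (f : G x) : IsAtom f.1 := by
  have := f.isAtom_comp x.2.1 ident_le_rect
  rwa [of_le_rect_comp f.2.2.2] at this

/-- Every nonzero element below `x ; 1 ; x` has a member of `G x` below it. -/
theorem exists_G_le (h0 : c ≠ ⊥) (hc : c ≤ rect x x) : ∃ f : G x, f.1 ≤ c := by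
  obtain ⟨S, hS, hlub⟩ := x.2.2.2
  by_contra hcon
  push Not at hcon
  have hub : rect x x ≤ cᶜ := hlub.2 fun g hg => le_compl_iff_disjoint_right.2 (by
    by_contra hd
    rw [disjoint_iff] at hd
    exact hcon ⟨g ⊓ c, hd, (comp_mono (conv_mono inf_le_left) inf_le_left).trans (hS g hg),
      inf_le_right.trans hc⟩ inf_le_right)
  exact h0 (disjoint_self.1 (le_compl_iff_disjoint_right.1 (hc.trans hub)))

theorem isLUB_G (hc : c ≤ rect x x) : IsLUB {e : A | ∃ f : G x, f.1 ≤ c ∧ e = f.1} c := by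
  refine ⟨?_, fun u hu => ?_⟩
  · rintro _ ⟨f, hf, rfl⟩
    exact hf
  · by_contra hcu
    obtain ⟨f, hf⟩ := exists_G_le (x := x) (c := c \ u)
      (fun h => hcu (sdiff_eq_bot_iff.1 h)) (sdiff_le.trans hc)
    have h1 : f.1 ≤ u := hu ⟨f, hf.trans sdiff_le, rfl⟩
    exact f.2.1 (disjoint_self.1 (disjoint_sdiff_self_right.mono h1 hf))

theorem atom_le_of_isLUB {S : Set A} (hS : ∀ s ∈ S, IsAtom s) (hc : IsLUB S c)
    (he : IsAtom e) (h : e ≤ c) : e ∈ S := by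
  by_contra hn
  have hub : c ≤ eᶜ := hc.2 fun s hs => le_compl_iff_disjoint_right.2 (by
    rcases (hS s hs).disjoint_of_ne he (fun h => hn (h ▸ hs)) with h'
    exact h')
  exact he.1 (disjoint_self.1 (le_compl_iff_disjoint_right.1 (h.trans hub)))

/-- The sum of a set of group elements contains no other group elements. -/
theorem isLUB_G_iff (hc : c ≤ rect x x) (L : Set (G x)) :
    IsLUB {e : A | ∃ f ∈ L, e = f.1} c ↔ ∀ f : G x, f.1 ≤ c ↔ f ∈ L := by
  constructor
  · intro h f
    refine ⟨fun hf => ?_, fun hf => h.1 ⟨f, hf, rfl⟩⟩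
    obtain ⟨g, hg, he⟩ := atom_le_of_isLUB
      (by rintro _ ⟨g, -, rfl⟩; exact g.isAtom) h f.isAtom hf
    rwa [Subtype.ext he]
  · intro h
    have := isLUB_G hc
    simpa only [h] using this

/-- The nonzero element `b ; a˘` lies below `x ; 1 ; x` and so contains a group element, which the
cycle law turns into an overlap. Applied to atoms this gives transitivity. -/
theorem exists_not_disjoint_comp (ha0 : a ≠ ⊥) (ha : a ≤ rect x y) (hb0 : b ≠ ⊥)
    (hb : b ≤ rect x y) : ∃ f : G x, ¬ Disjoint (f.1 ⨾ a) b := by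
  obtain ⟨f, hf⟩ := exists_G_le (x := x) (c := b ⨾ a˘)
    (comp_ne_bot hb0 hb (subident_conv_ne ha0) (conv_le_rect ha))
    (comp_le_rect hb (conv_le_rect ha))
  refine ⟨f, fun h => f.2.1 ?_⟩
  rw [disjoint_comp_iff_right] at h
  exact disjoint_self.1 (h.mono_right hf)

theorem G.le_comp_conv_iff (f : G x) : f.1 ≤ b ⨾ a˘ ↔ ¬ Disjoint (f.1 ⨾ a) b := by
  rw [disjoint_comp_iff_right, f.isAtom.not_disjoint_iff_le]

theorem exists_atom_le [Finite (G x)] (hb0 : b ≠ ⊥) (hb : b ≤ rect x y) :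
    ∃ d, IsAtom d ∧ d ≤ b := by
  classical
  -- Descent on the number of `f` for which `f ; a` meets `a`. If `b'` were a proper nonzero part of
  -- the minimal `d`, some `f` would move a nonzero `w ≤ b'` into `d \ b'`; this `f` is counted for
  -- `d` but not for `w`.
  obtain ⟨d, ⟨hd0, hdb⟩, hmin⟩ := WellFounded.has_min
    (InvImage.wf (fun a : A => {f : G x | ¬ Disjoint (f.1 ⨾ a) a}.ncard) wellFounded_lt)
    {a | a ≠ ⊥ ∧ a ≤ b} ⟨b, hb0, le_rfl⟩
  refine ⟨d, ⟨hd0, fun b' hb' => ?_⟩, hdb⟩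
  by_contra hb0'
  have hdl := hdb.trans hb
  have hc0 : d \ b' ≠ ⊥ := fun h => hb'.not_ge (sdiff_eq_bot_iff.1 h)
  obtain ⟨f, hf⟩ := exists_not_disjoint_comp hb0' (hb'.le.trans hdl) hc0 (sdiff_le.trans hdl)
  have hw0 : b' ⊓ ((f⁻¹).1 ⨾ (d \ b')) ≠ ⊥ := by
    rwa [G.disjoint_comp, disjoint_iff] at hf
  set w := b' ⊓ ((f⁻¹).1 ⨾ (d \ b')) with hw
  have hwd : w ≤ d := inf_le_left.trans hb'.le
  have hfw : f.1 ⨾ w ≤ d \ b' := by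
    have := comp_mono_right f.1 (inf_le_right : w ≤ (f⁻¹).1 ⨾ (d \ b'))
    rwa [f.comp_inv_comp (sdiff_le.trans hdl)] at this
  refine hmin w ⟨hw0, hwd.trans hdb⟩ (Set.ncard_lt_ncard ⟨?_, ?_⟩ (Set.toFinite _))
  · exact fun g hg h => hg (h.mono (comp_mono_right _ hwd) hwd)
  · intro hsub
    have h1 : f ∈ {f : G x | ¬ Disjoint (f.1 ⨾ d) d} := fun h =>
      hf (h.mono (comp_mono_right _ hb'.le) sdiff_le)
    exact hsub h1 (disjoint_sdiff_self_left.mono hfw inf_le_left)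

theorem le_of_atoms [Finite (G x)] (hb : b ≤ rect x y)
    (h : ∀ d, IsAtom d → d ≤ b → d ≤ c) : b ≤ c := by
  by_contra hbc
  obtain ⟨d, hd, hdl⟩ := exists_atom_le (x := x) (y := y) (b := b \ c)
    (fun h => hbc (sdiff_eq_bot_iff.1 h)) (sdiff_le.trans hb)
  exact hd.1 (disjoint_self.1 (disjoint_sdiff_self_left.mono hdl (h d hd (hdl.trans sdiff_le))))

theorem exists_comp_eq (hd : IsAtom d) (hdl : d ≤ rect x y) (he : IsAtom e)
    (hel : e ≤ rect x y) : ∃ f : G x, f.1 ⨾ d = e := by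
  obtain ⟨f, hf⟩ := exists_not_disjoint_comp hd.1 hdl he.1 hel
  refine ⟨f, ?_⟩
  by_contra hne
  exact hf ((f.isAtom_comp hd hdl).disjoint_of_ne he hne)

theorem exists_comp_eq_right (hd : IsAtom d) (hdl : d ≤ rect x y) (he : IsAtom e)
    (hel : e ≤ rect x y) : ∃ g : G y, d ⨾ g.1 = e := by
  obtain ⟨g, hg⟩ := exists_comp_eq (isAtom_conv.2 hd) (conv_le_rect hdl) (isAtom_conv.2 he)
    (conv_le_rect hel)
  refine ⟨g⁻¹, ?_⟩
  rw [← conv_conv e, ← hg, G.conv_comp_inv, conv_conv]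

end Action

/-! ### Blocks of imprimitivity and their stabilizers. -/

section Blocks

variable {A : Type u} [RelationAlgebra A] {x y z : MeasurableAtom A} {a b c d e : A}

/-- Reduces right stabilizers to left ones, so that only left stabilizers need a theory. -/
theorem rightStab_eq (ha : a ≤ rect x y) : rightStab y a = leftStab y (a˘) := by
  ext g
  rw [mem_rightStab ha, ← inv_mem_iff (x := g), mem_leftStab (conv_le_rect ha),
    ← convIso.injective.eq_iff (a := a ⨾ g.1)]
  change (a ⨾ g.1)˘ = a˘ ↔ _
  rw [conv_comp]
  rfl

theorem comp_eq_comp_iff (ha : a ≤ rect x y) (f g : G x) :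
    f.1 ⨾ a = g.1 ⨾ a ↔ f⁻¹ * g ∈ leftStab x a := by
  rw [mem_leftStab ha, G.mul_comp]
  constructor
  · intro h
    rw [← h, f.inv_comp_comp ha]
  · intro h
    rw [← f.comp_inv_comp (g.comp_le ha), h]

theorem index_eq_card_range (ha : a ≤ rect x y) :
    index x a = Nat.card (Set.range fun f : G x => f.1 ⨾ a) :=
  (card_range_eq_index _ _ (comp_eq_comp_iff ha)).symm

/-- The blocks of imprimitivity below `x ; 1 ; y` for the action of `G x` by relative
multiplication. -/
def IsBlock (x y : MeasurableAtom A) (a : A) : Prop :=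
  a ≤ rect x y ∧ a ≠ ⊥ ∧ ∀ f : G x, ¬ Disjoint (f.1 ⨾ a) a → f.1 ⨾ a = a

theorem isBlock_of_isAtom (hd : IsAtom d) (hl : d ≤ rect x y) : IsBlock x y d :=
  ⟨hl, hd.1, fun f hf => by
    by_contra hne
    exact hf ((f.isAtom_comp hd hl).disjoint_of_ne hd hne)⟩

theorem isBlock_self : IsBlock x x (x : A) := isBlock_of_isAtom x.2.1 ident_le_rect

theorem isBlock_rect (h : E x y) : IsBlock x y (rect x y) :=
  ⟨le_rfl, h, fun f _ => le_antisymm (f.comp_le le_rfl) (by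
    have := comp_mono_right f.1 ((f⁻¹).comp_le (le_refl (rect x y)))
    rwa [f.comp_inv_comp le_rfl] at this)⟩

theorem index_rect : index x (rect x y) = 1 := by
  refine Subgroup.index_eq_one.2 (eq_top_iff.2 fun f _ => (mem_leftStab le_rfl f).2 ?_)
  refine le_antisymm (f.comp_le le_rfl) ?_
  have := comp_mono_right f.1 ((f⁻¹).comp_le (le_refl (rect x y)))
  rwa [f.comp_inv_comp le_rfl] at this

theorem IsBlock.mem_leftStab_of_le (ha : IsBlock x y a) {f : G x} (h : f.1 ≤ a ⨾ a˘) :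
    f ∈ leftStab x a :=
  (mem_leftStab ha.1 f).2 (ha.2.2 f (f.le_comp_conv_iff.1 h))

theorem IsBlock.le_comp_conv_iff (ha : IsBlock x y a) (f : G x) :
    f.1 ≤ a ⨾ a˘ ↔ f ∈ leftStab x a := by
  refine ⟨ha.mem_leftStab_of_le, fun h => ?_⟩
  rw [f.le_comp_conv_iff, (mem_leftStab ha.1 f).1 h, disjoint_self]
  exact ha.2.1

/-- A group element moving one atom of a block into the block stabilizes the block. -/
theorem IsBlock.comp_eq_of_atom (ha : IsBlock x y a) (hd : IsAtom d) (hda : d ≤ a) {f : G x}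
    (h : f.1 ⨾ d ≤ a) : f.1 ⨾ a = a :=
  ha.2.2 f fun hdis => comp_ne_bot f.2.1 f.2.2.2 hd.1 (hda.trans ha.1)
    (disjoint_self.1 (hdis.mono (comp_mono_right _ hda) h))

/-- Two blocks that meet intersect in a block. -/
theorem IsBlock.inf (hb : IsBlock x y b) (hc : IsBlock x y c) (h : b ⊓ c ≠ ⊥) :
    IsBlock x y (b ⊓ c) ∧ leftStab x (b ⊓ c) = leftStab x b ⊓ leftStab x c := by
  have hle : b ⊓ c ≤ rect x y := inf_le_left.trans hb.1
  have hfix : ∀ f : G x, f.1 ⨾ b = b → f.1 ⨾ c = c → f.1 ⨾ (b ⊓ c) ≤ b ⊓ c := fun f h1 h2 =>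
    le_inf ((comp_mono_right _ inf_le_left).trans h1.le)
      ((comp_mono_right _ inf_le_right).trans h2.le)
  have hfix' : ∀ f : G x, f.1 ⨾ b = b → f.1 ⨾ c = c → f.1 ⨾ (b ⊓ c) = b ⊓ c := by
    refine fun f h1 h2 => le_antisymm (hfix f h1 h2) ?_
    have h3 := hfix f⁻¹ ((mem_leftStab hb.1 _).1 (inv_mem ((mem_leftStab hb.1 f).2 h1)))
      ((mem_leftStab hc.1 _).1 (inv_mem ((mem_leftStab hc.1 f).2 h2)))
    have := comp_mono_right f.1 h3
    rwa [f.comp_inv_comp hle] at this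
  have hstab : ∀ f : G x, ¬ Disjoint (f.1 ⨾ (b ⊓ c)) (b ⊓ c) →
      f.1 ⨾ b = b ∧ f.1 ⨾ c = c := fun f hf =>
    ⟨hb.2.2 f fun hd => hf (hd.mono (comp_mono_right _ inf_le_left) inf_le_left),
      hc.2.2 f fun hd => hf (hd.mono (comp_mono_right _ inf_le_right) inf_le_right)⟩
  refine ⟨⟨hle, h, fun f hf => hfix' f (hstab f hf).1 (hstab f hf).2⟩, ?_⟩
  ext f
  rw [Subgroup.mem_inf, mem_leftStab hle, mem_leftStab hb.1, mem_leftStab hc.1]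
  refine ⟨fun hf => hstab f ?_, fun hf => hfix' f hf.1 hf.2⟩
  rw [hf, disjoint_self]
  exact h

theorem E.symm (h : E x y) : E y x := fun h' => h (by rw [← rect_conv, h', conv_bot])

theorem E.trans (h : E x y) (h' : E y z) : E x z := fun h0 =>
  comp_ne_bot h le_rfl h' le_rfl (le_bot_iff.1 (h0 ▸ comp_le_rect le_rfl le_rfl))

theorem E.refl (x : MeasurableAtom A) : E x x := fun h =>
  x.2.1.1 (le_bot_iff.1 (h ▸ ident_le_rect))

theorem G.mul_comm [IsCyclic (G x)] (f g : G x) : f * g = g * f := IsCyclic.commGroup.mul_comm f g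

theorem comp_comp_eq (ha : a ≤ rect x y) (hb : b ≤ rect y z) {k l : G y}
    (hk : k ∈ leftStab y (a˘)) (hl : l ∈ leftStab y b) : a ⨾ ((k * l).1 ⨾ b) = a ⨾ b := by
  rw [← rightStab_eq ha, mem_rightStab ha] at hk
  rw [G.mul_comp, (mem_leftStab hb l).1 hl, comp_assoc, hk]

theorem leftStab_le_leftStab_comp (ha : a ≤ rect x y) (hb : b ≤ rect y z) :
    leftStab x a ≤ leftStab x (a ⨾ b) := by
  intro f hf
  rw [mem_leftStab (comp_le_rect ha hb), comp_assoc, (mem_leftStab ha f).1 hf]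

theorem m_dvd_card (x y : MeasurableAtom A) : m x y ∣ Nat.card (G x) := Subgroup.index_dvd_card _

theorem index_comp_dvd_left (ha : a ≤ rect x y) (hb : b ≤ rect y z) :
    index x (a ⨾ b) ∣ index x a :=
  Subgroup.index_dvd_of_le (leftStab_le_leftStab_comp ha hb)

/-- The atoms form one orbit, and stabilizers are constant along an orbit of a commutative group. -/
theorem leftStab_eq_H [IsCyclic (G x)] (hd : IsAtom d) (hl : d ≤ rect x y) : leftStab x d = H x y := by
  refine le_antisymm (le_iInf₂ fun e he => ?_) (iInf₂_le d ⟨hd, hl⟩)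
  obtain ⟨f, rfl⟩ := exists_comp_eq hd hl he.1 he.2
  intro g hg
  rw [mem_leftStab he.2, ← G.mul_comp, G.mul_comm, G.mul_comp, (mem_leftStab hl g).1 hg]

theorem index_eq_m [IsCyclic (G x)] (hd : IsAtom d) (hl : d ≤ rect x y) : index x d = m x y := by
  rw [index, leftStab_eq_H hd hl, m]

end Blocks

/-! ### Converses, products and meets of blocks when all groups are finite and cyclic. -/

section FiniteCyclic

variable {A : Type u} [RelationAlgebra A] [∀ x : MeasurableAtom A, Finite (G x)]
  {x y z : MeasurableAtom A} {a b c d e : A}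

/-- Every atom of `b` is `f ; d` for a common atom `d` and some `f` stabilizing `b`; such an `f`
also stabilizes `c`. -/
theorem IsBlock.le_of_leftStab_le (hb : IsBlock x y b) (hc : IsBlock x y c) (h : b ⊓ c ≠ ⊥)
    (hs : leftStab x b ≤ leftStab x c) : b ≤ c := by
  obtain ⟨d, hd, hdl⟩ := exists_atom_le h (inf_le_left.trans hb.1)
  refine le_of_atoms hb.1 fun e he heb => ?_
  obtain ⟨f, rfl⟩ := exists_comp_eq hd (hdl.trans (inf_le_left.trans hb.1)) he (heb.trans hb.1)
  have h1 := hb.comp_eq_of_atom hd (hdl.trans inf_le_left) heb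
  have h2 := (mem_leftStab hc.1 f).1 (hs ((mem_leftStab hb.1 f).2 h1))
  exact (comp_mono_right _ (hdl.trans inf_le_right)).trans h2.le

theorem m_ne_zero (x y : MeasurableAtom A) : m x y ≠ 0 := Subgroup.index_ne_zero_of_finite

theorem exists_isLUB_orbit (L : Subgroup (G x)) (d : A) :
    ∃ a, IsLUB {e : A | ∃ f ∈ L, e = f.1 ⨾ d} a := by
  have hfin : {e : A | ∃ f ∈ L, e = f.1 ⨾ d}.Finite := by
    refine (Set.finite_range fun f : G x => f.1 ⨾ d).subset ?_
    rintro _ ⟨f, -, rfl⟩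
    exact ⟨f, rfl⟩
  refine ⟨hfin.toFinset.sup id, ?_⟩
  have := Finset.isLUB_sup_id (s := hfin.toFinset)
  rwa [hfin.coe_toFinset] at this

variable [∀ x : MeasurableAtom A, IsCyclic (G x)]

/-- Multiplication by a group element on the left is multiplication by one on the right. -/
theorem exists_comp_right_eq (y : MeasurableAtom A) (f : G x) :
    ∃ g : G y, ∀ b ≤ rect x y, f.1 ⨾ b = b ⨾ g.1 := by
  by_cases h : rect x y = ⊥
  · refine ⟨1, fun b hb => ?_⟩
    rw [h, le_bot_iff] at hb
    rw [hb, comp_bot, bot_comp]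
  obtain ⟨d, hd, hdl⟩ := exists_atom_le h le_rfl
  obtain ⟨g, hg⟩ := exists_comp_eq_right hd hdl (f.isAtom_comp hd hdl) (f.comp_le hdl)
  -- The `g` found at the single atom `d` serves every atom `k ; d`, because `f` commutes with `k`.
  have hatom : ∀ e, IsAtom e → e ≤ rect x y → f.1 ⨾ e = e ⨾ g.1 := by
    intro e he hel
    obtain ⟨k, rfl⟩ := exists_comp_eq hd hdl he hel
    rw [← G.mul_comp, G.mul_comm, G.mul_comp, ← hg, comp_assoc]
  refine ⟨g, fun b hb => le_antisymm ?_ ?_⟩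
  · refine le_of_atoms (f.comp_le hb) fun e he heb => ?_
    have hel := heb.trans (f.comp_le hb)
    have h1 : (f⁻¹).1 ⨾ e ≤ b := by
      have := comp_mono_right (f⁻¹).1 heb
      rwa [f.inv_comp_comp hb] at this
    have h2 := hatom _ ((f⁻¹).isAtom_comp he hel) (h1.trans hb)
    rw [f.comp_inv_comp hel] at h2
    rw [h2]
    exact comp_mono_left _ h1
  · refine le_of_atoms (g.le_comp hb) fun e he heb => ?_
    have hel := heb.trans (g.le_comp hb)
    have h1 : e ⨾ (g⁻¹).1 ≤ b := by
      have := comp_mono_left (g⁻¹).1 heb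
      rwa [g.comp_comp_inv hb] at this
    have h2 := hatom _ ((g⁻¹).isAtom_comp_right he hel) (h1.trans hb)
    have h3 := (g⁻¹).comp_comp_inv hel
    rw [inv_inv] at h3
    rw [h3] at h2
    rw [← h2]
    exact comp_mono_right _ h1

theorem exists_comp_left_eq (x : MeasurableAtom A) (g : G y) :
    ∃ f : G x, ∀ b ≤ rect x y, f.1 ⨾ b = b ⨾ g.1 := by
  obtain ⟨f, hf⟩ := exists_comp_right_eq x g⁻¹
  refine ⟨f⁻¹, fun b hb => ?_⟩
  have h := congrArg conv (hf _ (conv_le_rect hb))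
  rw [G.conv_comp_inv, conv_comp, conv_conv, inv_inv] at h
  exact h.symm

theorem IsBlock.conv (ha : IsBlock x y a) : IsBlock y x (a˘) := by
  refine ⟨conv_le_rect ha.1, subident_conv_ne ha.2.1, fun g hg => ?_⟩
  obtain ⟨f, hf⟩ := exists_comp_left_eq x g⁻¹
  have h1 : (g.1 ⨾ a˘) = (f.1 ⨾ a)˘ := by
    rw [hf a ha.1, conv_comp, G.val_inv, conv_conv]
  rw [h1, disjoint_conv] at hg
  rw [h1, ha.2.2 f hg]

/-- The group elements below `a ; a˘` are those `f` for which `f ; a` meets `a`. Regularity on the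
left thus says that they all fix `a`; the right half follows since the converse of a block is a
block. -/
theorem isRegular_iff : IsRegular x y a ↔ IsBlock x y a := by
  constructor
  · rintro ⟨hl, hL, -⟩
    have h1 := (isLUB_G_iff (comp_le_rect hl (conv_le_rect hl)) (leftStab x a : Set (G x))).1 hL
    refine ⟨hl, fun h => ?_, fun f hf => ?_⟩
    · have h2 := (h1 1).2 (one_mem _)
      rw [h, bot_comp] at h2
      exact (1 : G x).2.1 (le_bot_iff.1 h2)
    · exact (mem_leftStab hl f).1 ((h1 f).1 (f.le_comp_conv_iff.2 hf))
  · intro ha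
    refine ⟨ha.1, (isLUB_G_iff (comp_le_rect ha.1 ha.conv.1) (leftStab x a : Set (G x))).2
      ha.le_comp_conv_iff, (isLUB_G_iff (comp_le_rect ha.conv.1 ha.1)
        (rightStab y a : Set (G y))).2 fun g => ?_⟩
    rw [rightStab_eq ha.1]
    have := ha.conv.le_comp_conv_iff g
    rwa [conv_conv] at this

/-- The index is the size of the orbit, and converse carries the orbit of `a˘` under `G y` onto that
of `a` under `G x`, left and right translates being the same elements. -/
theorem index_conv (ha : a ≤ rect x y) : index y (a˘) = index x a := by
  rw [index_eq_card_range ha, index_eq_card_range (conv_le_rect ha),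
    ← Nat.card_image_of_injective convIso.injective]
  congr 2
  ext b
  constructor
  · rintro ⟨_, ⟨g, rfl⟩, rfl⟩
    obtain ⟨f, hf⟩ := exists_comp_left_eq x g⁻¹
    refine ⟨f, ?_⟩
    change f.1 ⨾ a = (g.1 ⨾ a˘)˘
    rw [hf a ha, G.conv_comp_inv, conv_conv]
  · rintro ⟨f, rfl⟩
    obtain ⟨g, hg⟩ := exists_comp_right_eq y f
    refine ⟨_, ⟨g⁻¹, rfl⟩, ?_⟩
    change ((g⁻¹).1 ⨾ a˘)˘ = f.1 ⨾ a
    rw [hg a ha, G.conv_comp_inv, conv_conv, inv_inv]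

theorem IsBlock.exists_mul_of_not_disjoint (ha : IsBlock x y a) (hb : IsBlock y z b) {g : G y}
    (h : ¬ Disjoint (a ⨾ (g.1 ⨾ b)) (a ⨾ b)) :
    ∃ k ∈ leftStab y (a˘), ∃ l ∈ leftStab y b, k * l = g := by
  -- By the cycle laws, `a˘ ; a` meets `g ; (b ; b˘)`. A group element `k` below both stabilizes
  -- `a˘`, and `g⁻¹ * k` stabilizes `b`.
  rw [disjoint_comp_iff_left, disjoint_comm, comp_assoc, disjoint_comp_iff_right,
    disjoint_iff, ← comp_assoc] at h
  obtain ⟨k, hk⟩ := exists_G_le (x := y) h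
    (inf_le_left.trans (comp_le_rect ha.conv.1 ha.1))
  refine ⟨k, ha.conv.mem_leftStab_of_le ?_, k⁻¹ * g, ?_, mul_inv_cancel_left k g⟩
  · rw [conv_conv]
    exact hk.trans inf_le_left
  · rw [← inv_mem_iff, mul_inv_rev, inv_inv]
    refine hb.mem_leftStab_of_le ?_
    rw [G.val_mul]
    have := comp_mono_right (g⁻¹).1 (hk.trans inf_le_right)
    rwa [g.inv_comp_comp (comp_le_rect hb.1 hb.conv.1)] at this

/-- The product of two blocks is a block. -/
theorem IsBlock.comp (ha : IsBlock x y a) (hb : IsBlock y z b) : IsBlock x z (a ⨾ b) := by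
  refine ⟨comp_le_rect ha.1 hb.1, comp_ne_bot ha.2.1 ha.1 hb.2.1 hb.1, fun f hf => ?_⟩
  obtain ⟨g, hg⟩ := exists_comp_right_eq y f
  rw [comp_assoc, hg a ha.1, ← comp_assoc] at hf ⊢
  obtain ⟨k, hk, l, hl, rfl⟩ := ha.exists_mul_of_not_disjoint hb hf
  exact comp_comp_eq ha.1 hb.1 hk hl

/-- If `f` fixes `a ; b`, carry it across `a` to `g` in the middle. Then `g` is a product of
stabilizers of `a˘` and `b`, both of which `a` absorbs on the right, so `f` fixes `a`. -/
theorem IsBlock.leftStab_comp (ha : IsBlock x y a) (hb : IsBlock y z b)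
    (h : leftStab y b ≤ leftStab y (a˘)) : leftStab x (a ⨾ b) = leftStab x a := by
  refine le_antisymm (fun f hf => ?_) (leftStab_le_leftStab_comp ha.1 hb.1)
  rw [mem_leftStab (comp_le_rect ha.1 hb.1)] at hf
  obtain ⟨g, hg⟩ := exists_comp_right_eq y f
  rw [comp_assoc, hg a ha.1, ← comp_assoc] at hf
  obtain ⟨k, hk, l, hl, rfl⟩ := ha.exists_mul_of_not_disjoint hb (by
    rw [hf, disjoint_self]
    exact comp_ne_bot ha.2.1 ha.1 hb.2.1 hb.1)
  have h1 := mul_mem hk (h hl)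
  rw [← rightStab_eq ha.1, mem_rightStab ha.1] at h1
  rw [mem_leftStab ha.1, hg a ha.1, h1]

theorem index_comp_dvd_right (ha : a ≤ rect x y) (hb : b ≤ rect y z) :
    index x (a ⨾ b) ∣ index y b := by
  rw [← index_conv (comp_le_rect ha hb), conv_comp, ← index_conv hb]
  exact index_comp_dvd_left (conv_le_rect hb) (conv_le_rect ha)

theorem m_comm (x y : MeasurableAtom A) (h : E x y) : m y x = m x y := by
  obtain ⟨d, hd, hl⟩ := exists_atom_le h le_rfl
  rw [← index_eq_m hd hl, ← index_conv hl, index_eq_m (isAtom_conv.2 hd) (conv_le_rect hl)]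

/-- An element of `H x y` fixes every atom, and `a` is determined by the atoms below it. -/
theorem H_le_leftStab (ha : a ≤ rect x y) : H x y ≤ leftStab x a := by
  have key : ∀ f ∈ H x y, a ≤ f.1 ⨾ a := by
    refine fun f hf => le_of_atoms ha fun e he hea => ?_
    rw [← leftStab_eq_H he (hea.trans ha), mem_leftStab (hea.trans ha)] at hf
    rw [← hf]
    exact comp_mono_right _ hea
  intro f hf
  refine (mem_leftStab ha f).2 (le_antisymm ?_ (key f hf))
  have := comp_mono_right f.1 (key f⁻¹ (inv_mem hf))
  rwa [f.comp_inv_comp ha] at this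

theorem index_dvd_m (ha : a ≤ rect x y) : index x a ∣ m x y :=
  Subgroup.index_dvd_of_le (H_le_leftStab ha)

theorem leftStab_le_of_index_dvd (h : index x b ∣ index x a) : leftStab x a ≤ leftStab x b :=
  subgroup_le_iff_index_dvd.2 h

theorem IsBlock.isAtom_of_index (ha : IsBlock x y a) (h : index x a = m x y) : IsAtom a := by
  obtain ⟨d, hd, hda⟩ := exists_atom_le ha.2.1 ha.1
  have hdl := hda.trans ha.1
  have : a ≤ d := ha.le_of_leftStab_le (isBlock_of_isAtom hd hdl)
    (by rw [inf_eq_right.2 hda]; exact hd.1)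
    (leftStab_le_of_index_dvd (by rw [h, index_eq_m hd hdl]))
  rwa [le_antisymm this hda]

/-- Blocks of coprime indices meet in a block whose index is the product. -/
theorem IsBlock.inf_of_coprime (hb : IsBlock x y b) (hc : IsBlock x y c)
    (h : (index x b).Coprime (index x c)) :
    IsBlock x y (b ⊓ c) ∧ index x (b ⊓ c) = index x b * index x c := by
  have hne : b ⊓ c ≠ ⊥ := by
    obtain ⟨d, hd, hdb⟩ := exists_atom_le hb.2.1 hb.1
    obtain ⟨e, he, hec⟩ := exists_atom_le hc.2.1 hc.1
    obtain ⟨f, rfl⟩ := exists_comp_eq hd (hdb.trans hb.1) he (hec.trans hc.1)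
    -- With `k` stabilizing `b` and `l` stabilizing `c`, the atom `k ; d = l⁻¹ ; (k * l) ; d` lies
    -- in both blocks.
    obtain ⟨k, hk, l, hl, rfl⟩ := exists_mul_of_index_coprime h f
    rw [mem_leftStab hb.1] at hk
    have h1 : k.1 ⨾ d ≤ b := (comp_mono_right _ hdb).trans hk.le
    have h2 : k.1 ⨾ d ≤ c := by
      have h3 := comp_mono_right (l⁻¹).1 hec
      rw [(mem_leftStab hc.1 _).1 (inv_mem hl), ← G.mul_comp, G.mul_comm k,
        inv_mul_cancel_left] at h3
      exact h3
    intro h0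
    exact comp_ne_bot k.2.1 k.2.2.2 hd.1 (hdb.trans hb.1)
      (le_bot_iff.1 ((le_inf h1 h2).trans h0.le))
  obtain ⟨h1, h2⟩ := hb.inf hc hne
  refine ⟨h1, ?_⟩
  rw [index, h2]
  exact index_inf_of_coprime h

/-- The orbit of an atom under a subgroup containing `H_xy` is a block. -/
theorem isBlock_of_isLUB (hd : IsAtom d) (hl : d ≤ rect x y) {L : Subgroup (G x)}
    (hL : H x y ≤ L) (ha : IsLUB {e : A | ∃ f ∈ L, e = f.1 ⨾ d} a) :
    IsBlock x y a ∧ leftStab x a = L ∧ d ≤ a := by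
  have hal : a ≤ rect x y := ha.2 (by rintro _ ⟨f, -, rfl⟩; exact f.comp_le hl)
  have hda : d ≤ a := ha.1 ⟨1, one_mem _, (G.one_comp hl).symm⟩
  have hS : ∀ s ∈ {e : A | ∃ f ∈ L, e = f.1 ⨾ d}, IsAtom s := by
    rintro _ ⟨f, -, rfl⟩
    exact f.isAtom_comp hd hl
  have hatom : ∀ e, IsAtom e → e ≤ a → ∃ f ∈ L, e = f.1 ⨾ d := by
    intro e he hea
    have h := atom_le_of_isLUB hS ha he hea
    exact h
  have hle : ∀ f ∈ L, a ≤ f.1 ⨾ a := by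
    refine fun f hf => le_of_atoms hal fun e he hea => ?_
    obtain ⟨k, hk, rfl⟩ := hatom e he hea
    have h1 : (f⁻¹ * k).1 ⨾ d ≤ a := ha.1 ⟨_, mul_mem (inv_mem hf) hk, rfl⟩
    have h2 := comp_mono_right f.1 h1
    rwa [← G.mul_comp, mul_inv_cancel_left] at h2
  have heq : ∀ f ∈ L, f.1 ⨾ a = a := by
    refine fun f hf => le_antisymm ?_ (hle f hf)
    have := comp_mono_right f.1 (hle f⁻¹ (inv_mem hf))
    rwa [f.comp_inv_comp hal] at this
  have hmem : ∀ f : G x, ¬ Disjoint (f.1 ⨾ a) a → f ∈ L := by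
    intro f hf
    obtain ⟨e, he, hel⟩ := exists_atom_le (x := x) (y := y)
      (fun h => hf (disjoint_iff.2 h)) (inf_le_right.trans hal)
    obtain ⟨k, hk, rfl⟩ := hatom e he (hel.trans inf_le_right)
    have h1 := comp_mono_right (f⁻¹).1 (hel.trans inf_le_left)
    rw [f.inv_comp_comp hal] at h1
    -- The atom `k ; d` lies in `a` and in `f ; a`, so `f⁻¹ * k` and `l` agree on `d`. They differ
    -- by an element of `H x y ≤ L`, which forces `f ∈ L`.
    obtain ⟨l, hl', h2⟩ := hatom _ ((f⁻¹).isAtom_comp he (k.comp_le hl)) h1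
    rw [← G.mul_comp, comp_eq_comp_iff hl, leftStab_eq_H hd hl] at h2
    have h3 := hL h2
    have h4 : f = k * ((f⁻¹ * k)⁻¹ * l) * l⁻¹ := by group
    rw [h4]
    exact mul_mem (mul_mem hk h3) (inv_mem hl')
  refine ⟨⟨hal, fun h => hd.1 (le_bot_iff.1 (h ▸ hda)), fun f hf => heq f (hmem f hf)⟩, ?_, hda⟩
  ext f
  rw [mem_leftStab hal]
  refine ⟨fun h => hmem f ?_, heq f⟩
  rw [h, disjoint_self]
  exact fun h => hd.1 (le_bot_iff.1 (h ▸ hda))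

end FiniteCyclic

/-! ### The relations `∼_k` and the construction of a `p`-system, level by level. -/

section Levels

variable {A : Type u} [RelationAlgebra A] {x y z : MeasurableAtom A} {a b : A} {p k l : ℕ}

theorem Sim.refl (p k : ℕ) (x : MeasurableAtom A) : Sim p k x x := Or.inl rfl

theorem Sim.E (h : Sim p k x y) : E x y := by
  rcases h with rfl | h
  · exact E.refl _
  · exact h.1

theorem Sim.dvd (h : Sim p k x y) (hne : x ≠ y) : p ^ k ∣ m x y := (h.resolve_left hne).2

theorem Sim.mono (h : Sim p k x y) (hl : l ≤ k) : Sim p l x y :=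
  h.imp_right fun h => ⟨h.1, (pow_dvd_pow p hl).trans h.2⟩

theorem rect_comp_rect (h : E x y) : rect x y ⨾ rect y z = rect x z := by
  refine le_antisymm (comp_le_rect le_rfl le_rfl) ?_
  have h1 := comp_mono_left (rect x z) (le_comp_conv_self h le_rfl)
  rw [comp_of_le_rect le_rfl, rect_conv, ← comp_assoc] at h1
  exact h1.trans (comp_mono_right _ (comp_le_rect le_rfl le_rfl))

/-- The properties of the elements of a fixed level `k` of a `p`-system. -/
structure IsLevel (p k : ℕ) (a : MeasurableAtom A → MeasurableAtom A → A) : Prop where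
  block : ∀ x y, Sim p k x y → IsBlock x y (a x y)
  diag : ∀ x, a x x = x
  index_eq : ∀ x y, Sim p k x y → x ≠ y → index x (a x y) = p ^ k
  conv_eq : ∀ x y, Sim p k x y → a y x = (a x y)˘
  eq_comp : ∀ x y z, Sim p k x y → Sim p k y z → x ≠ z → a x z = a x y ⨾ a y z

theorem IsLevel.le_comp {a : MeasurableAtom A → MeasurableAtom A → A} (h : IsLevel p k a)
    (hxy : Sim p k x y) (hyz : Sim p k y z) : a x z ≤ a x y ⨾ a y z := by
  by_cases hxz : x = z
  · subst hxz
    rw [h.diag, h.conv_eq x y hxy]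
    exact le_comp_conv_self (h.block x y hxy).2.1 (h.block x y hxy).1
  · exact (h.eq_comp x y z hxy hyz hxz).le

variable [∀ x : MeasurableAtom A, Finite (G x)] [∀ x : MeasurableAtom A, IsCyclic (G x)]

theorem exists_isBlock_of_dvd (h : E x y) {n : ℕ} (hn : n ∣ m x y) :
    ∃ a, IsBlock x y a ∧ index x a = n := by
  obtain ⟨d, hd, hl⟩ := exists_atom_le h le_rfl
  obtain ⟨L, hL⟩ := exists_subgroup_index_eq (hn.trans (m_dvd_card x y))
  obtain ⟨a, ha⟩ := exists_isLUB_orbit L d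
  obtain ⟨h1, h2, -⟩ := isBlock_of_isLUB hd hl (subgroup_le_iff_index_dvd.2 (by rwa [hL])) ha
  exact ⟨a, h1, by rw [index, h2, hL]⟩

/-- A block absorbs products `b˘ ; b` of blocks with smaller right stabilizer. -/
theorem IsBlock.comp_conv_comp (ha : IsBlock x y a) (hb : IsBlock z y b)
    (h : leftStab y (b˘) ≤ leftStab y (a˘)) : a ⨾ (b˘ ⨾ b) = a := by
  have hbb : b˘ ⨾ b ≤ rect y y := comp_le_rect hb.conv.1 hb.1
  refine le_antisymm ?_ ?_
  -- If the product left `a`, a single group element `g ≤ b˘ ; b` would already move `a` into its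
  -- complement. But `g` stabilizes `b˘`, hence `a ; g = a`.
  · rw [← disjoint_compl_right_iff, disjoint_comp_iff_left, disjoint_iff]
    by_contra hne
    obtain ⟨g, hg⟩ := exists_G_le (x := y) hne (inf_le_left.trans hbb)
    have h1 : g ∈ leftStab y (b˘) := hb.conv.mem_leftStab_of_le (by
      rw [conv_conv]; exact hg.trans inf_le_left)
    have h2 := h h1
    rw [← rightStab_eq ha.1, mem_rightStab ha.1] at h2
    have h3 : ¬ Disjoint (a ⨾ g.1) aᶜ := by
      rw [disjoint_comp_iff_left, g.isAtom.not_disjoint_iff_le]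
      exact hg.trans inf_le_right
    rw [h2] at h3
    exact h3 disjoint_compl_right
  · have h1 := comp_mono_right a (le_conv_comp hb.2.1 hb.1)
    rwa [of_le_rect_comp ha.1] at h1

theorem leftStab_conv_le_of_index_dvd (ha : a ≤ rect x y) (hb : b ≤ rect z y)
    (h : index x a ∣ index z b) : leftStab y (b˘) ≤ leftStab y (a˘) :=
  leftStab_le_of_index_dvd (by rwa [index_conv ha, index_conv hb])

theorem Sim.symm (h : Sim p k x y) : Sim p k y x := by
  rcases h with rfl | h
  · exact .refl _ _ _
  · exact Or.inr ⟨h.1.symm, by rw [m_comm x y h.1]; exact h.2⟩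

/-- Blocks of index `p ^ k` over `(x, y)` and `(y, z)` have the same stabilizer in `G y`. Their
product therefore has index `p ^ k`, which must divide `m x z`. -/
theorem Sim.trans (h : Sim p k x y) (h' : Sim p k y z) : Sim p k x z := by
  rcases h with rfl | h
  · exact h'
  rcases h' with rfl | h'
  · exact Or.inr h
  obtain ⟨a, ha, hai⟩ := exists_isBlock_of_dvd h.1 h.2
  obtain ⟨b, hb, hbi⟩ := exists_isBlock_of_dvd h'.1 h'.2
  refine Or.inr ⟨h.1.trans h'.1, ?_⟩
  have h1 := ha.leftStab_comp hb
    (leftStab_le_of_index_dvd (by rw [index_conv ha.1, hai, hbi]))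
  rw [← hai, index, ← h1]
  exact index_dvd_m (ha.comp hb).1

theorem isLevel_zero {a : MeasurableAtom A → MeasurableAtom A → A} (hd : ∀ x, a x x = x)
    (h : ∀ x y, Sim p 0 x y → x ≠ y → a x y = rect x y) : IsLevel p 0 a where
  block x y hs := by
    by_cases hxy : x = y
    · subst hxy
      rw [hd]
      exact isBlock_self
    · rw [h x y hs hxy]
      exact isBlock_rect hs.E
  diag := hd
  index_eq x y hs hxy := by rw [h x y hs hxy, index_rect, pow_zero]
  conv_eq x y hs := by
    by_cases hxy : x = y
    · subst hxy
      rw [hd, MeasurableAtom.conv_eq]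
    · rw [h x y hs hxy, h y x hs.symm (Ne.symm hxy), rect_conv]
  eq_comp x y z hxy hyz hxz := by
    rw [h x z (hxy.trans hyz) hxz]
    by_cases h1 : x = y
    · subst h1
      rw [hd, h x z hyz hxz, comp_of_le_rect le_rfl]
    by_cases h2 : y = z
    · subst h2
      rw [hd, h x y hxy hxz, of_le_rect_comp le_rfl]
    rw [h x y hxy h1, h y z hyz h2, rect_comp_rect hxy.E]

/-- Each `c y` is a block below `prev y (r y)`. Everything else follows from products `c x ; (c y)˘`
in which at least one of two distinct points is not the representative; the arguments run from that
side. -/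
theorem IsStep.isLevel {prev next : MeasurableAtom A → MeasurableAtom A → A}
    (hp : IsLevel p k prev) (hs : IsStep p (k + 1) prev next) :
    IsLevel p (k + 1) next ∧ ∀ x y, Sim p (k + 1) x y → next x y ≤ prev x y := by
  obtain ⟨r, c, hr, hrr, hc1, hc2, hd, hn⟩ := hs
  have hc : ∀ y, IsBlock y (r y) (c y) ∧ c y ≤ prev y (r y) ∧
      (y ≠ r y → index y (c y) = p ^ (k + 1)) := by
    intro y
    by_cases hy : y = r y
    · rw [hc1 y hy, ← hy, hp.diag]
      exact ⟨isBlock_self, le_rfl, fun h => absurd rfl h⟩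
    · obtain ⟨d, L, hda, hdp, hL, hlub⟩ := hc2 y hy
      have hs' := (hr y).mono (Nat.le_succ k)
      have hB := hp.block _ _ hs'
      obtain ⟨h1, h2, h3⟩ := isBlock_of_isLUB hda (hdp.trans hB.1)
        (subgroup_le_iff_index_dvd.2 (by rw [hL]; exact (hr y).dvd hy)) hlub
      have hi : index y (c y) = p ^ (k + 1) := by rw [index, h2, hL]
      refine ⟨h1, h1.le_of_leftStab_le hB ?_ (leftStab_le_of_index_dvd ?_), fun _ => hi⟩
      · exact fun h => hda.1 (le_bot_iff.1 ((le_inf h3 hdp).trans h.le))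
      · rw [hi, hp.index_eq _ _ hs' hy]
        exact pow_dvd_pow p (Nat.le_succ k)
  have hcb : ∀ x y, r x = r y → IsBlock y (r x) (c y) := fun x y h => h ▸ (hc y).1
  -- If `y` is the representative, `c y` is `y` with trivial stabilizer and index `|G y|`. This is
  -- generally not `p ^ (k + 1)`, but is divisible by it because `m y x` divides `|G y|`.
  have hdiv : ∀ x y, r x = r y → x ≠ r x → index x (c x) ∣ index y (c y) := by
    intro x y hxy hx
    rw [(hc x).2.2 hx]
    by_cases hy : y = r y
    · have h1 : index y (c y) = Nat.card (G y) := by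
        rw [hc1 y hy, ← hy, ← Subgroup.index_bot, index]
        congr 1
        refine (Subgroup.eq_bot_iff_forall _).2 fun f hf => ?_
        rw [mem_leftStab ident_le_rect, of_le_rect_comp f.2.2.2] at hf
        exact Subtype.ext hf
      rw [h1]
      have h2 := hr x
      rw [hxy, ← hy] at h2
      exact (h2.symm.dvd fun h => hx (by rw [hxy, ← hy, h])).trans (m_dvd_card y x)
    · rw [(hc y).2.2 hy]
  have hidx : ∀ x y, r x = r y → x ≠ r x → index x (c x ⨾ (c y)˘) = p ^ (k + 1) := by
    intro x y hxy hx
    rw [index, (hc x).1.leftStab_comp (hcb x y hxy).conv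
      (leftStab_conv_le_of_index_dvd (hc x).1.1 (hcb x y hxy).1 (hdiv x y hxy hx))]
    exact (hc x).2.2 hx
  have habs : ∀ x y, r x = r y → x ≠ r x → c x ⨾ ((c y)˘ ⨾ c y) = c x := fun x y hxy hx =>
    (hc x).1.comp_conv_comp (hcb x y hxy)
      (leftStab_conv_le_of_index_dvd (hc x).1.1 (hcb x y hxy).1 (hdiv x y hxy hx))
  have hblock : ∀ x y, Sim p (k + 1) x y → IsBlock x y (next x y) := by
    intro x y hxy
    by_cases h : x = y
    · subst h
      rw [hd]
      exact isBlock_self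
    · rw [hn x y hxy h]
      exact (hc x).1.comp (hcb x y (hrr x y hxy)).conv
  refine ⟨⟨hblock, hd, ?_, ?_, ?_⟩, ?_⟩
  · intro x y hxy hne
    have hb := hblock x y hxy
    rw [hn x y hxy hne] at hb ⊢
    by_cases hx : x = r x
    · have hy : y ≠ r y := fun hy => hne (by rw [hx, hy, hrr x y hxy])
      rw [← index_conv hb.1, conv_comp, conv_conv]
      exact hidx y x (hrr x y hxy).symm hy
    · exact hidx x y (hrr x y hxy) hx
  · intro x y hxy
    by_cases h : x = y
    · subst h
      rw [hd, MeasurableAtom.conv_eq]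
    · rw [hn x y hxy h, hn y x hxy.symm (Ne.symm h), conv_comp, conv_conv]
  · intro x y z hxy hyz hxz
    by_cases h1 : x = y
    · subst h1
      rw [hd, comp_of_le_rect (hblock x z hyz).1]
    by_cases h2 : y = z
    · subst h2
      rw [hd, of_le_rect_comp (hblock x y hxy).1]
    rw [hn x y hxy h1, hn y z hyz h2, hn x z (hxy.trans hyz) hxz]
    -- The middle factor `(c y)˘ ; c y` is absorbed by `c x`, or, when `x` is the representative, by
    -- `(c z)˘`.
    by_cases hx : x = r x
    · have hrxz := hrr x z (hxy.trans hyz)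
      have hz : z ≠ r z := fun hz => hxz (by rw [hx, hz, hrxz])
      have h3 := congrArg conv (habs z y (hrr y z hyz).symm hz)
      simp only [conv_comp, conv_conv] at h3
      rw [← comp_assoc, comp_assoc (c y)˘, h3]
    · have h3 := habs x y (hrr x y hxy) hx
      rw [comp_assoc, ← comp_assoc (c x), h3]
  · intro x y hxy
    by_cases h : x = y
    · subst h
      rw [hd, hp.diag]
    · have h1 := (hr x).mono (Nat.le_succ k)
      have h2 := (hr y).mono (Nat.le_succ k)
      rw [hn x y hxy h, hp.eq_comp x (r x) y h1 (by rw [hrr x y hxy]; exact h2.symm) h]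
      refine comp_mono (hc x).2.1 ?_
      rw [hrr x y hxy, hp.conv_eq _ _ h2]
      exact conv_mono (hc y).2.1

theorem IsConstructed.isLevel {a : ℕ → MeasurableAtom A → MeasurableAtom A → A}
    (h : IsConstructed p a) (k : ℕ) : IsLevel p k (a k) := by
  induction k with
  | zero => exact isLevel_zero h.1 h.2.1
  | succ k ih => exact (IsStep.isLevel ih (h.2.2 k)).1

theorem IsConstructed.isPrimeSystem {a : ℕ → MeasurableAtom A → MeasurableAtom A → A}
    (h : IsConstructed p a) : IsPrimeSystem p a where
  regular k x y hxy := isRegular_iff.2 ((h.isLevel k).block x y hxy)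
  zero := h.2.1
  diag k := (h.isLevel k).diag
  index_eq k := (h.isLevel k).index_eq
  conv_eq k := (h.isLevel k).conv_eq
  le_comp k _ _ _ hxy hyz := (h.isLevel k).le_comp hxy hyz
  eq_comp k := (h.isLevel k).eq_comp
  antitone k := (IsStep.isLevel (h.isLevel k) (h.2.2 k)).2

theorem IsLevel.exists_isStep {prev : MeasurableAtom A → MeasurableAtom A → A}
    (hp : IsLevel p k prev) : ∃ next, IsStep p (k + 1) prev next := by
  classical
  let s : Setoid (MeasurableAtom A) :=
    ⟨Sim p (k + 1), Sim.refl p (k + 1), fun h => h.symm, fun h h' => h.trans h'⟩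
  let r : MeasurableAtom A → MeasurableAtom A := fun x => (Quotient.mk s x).out
  have hr : ∀ x, Sim p (k + 1) x (r x) := fun x => Sim.symm (Quotient.mk_out (s := s) x)
  have hc : ∀ y, ∃ c : A, (y = r y → c = r y) ∧
      (y ≠ r y → ∃ (d : A) (L : Subgroup (G y)), IsAtom d ∧ d ≤ prev y (r y) ∧
        L.index = p ^ (k + 1) ∧ IsLUB {e : A | ∃ f ∈ L, e = f.1 ⨾ d} c) := by
    intro y
    by_cases hy : y = r y
    · exact ⟨r y, fun _ => rfl, fun h => absurd hy h⟩
    · have hB := hp.block _ _ ((hr y).mono (Nat.le_succ k))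
      obtain ⟨d, hd, hdl⟩ := exists_atom_le hB.2.1 hB.1
      obtain ⟨L, hL⟩ := exists_subgroup_index_eq
        (((hr y).dvd hy).trans (m_dvd_card y (r y)))
      obtain ⟨c, hc⟩ := exists_isLUB_orbit L d
      exact ⟨c, fun h => absurd h hy, fun _ => ⟨d, L, hd, hdl, hL, hc⟩⟩
  choose c hc1 hc2 using hc
  refine ⟨fun x y => if x = y then x else c x ⨾ (c y)˘, r, c, hr, fun x y hxy => ?_, hc1, hc2,
    fun x => if_pos rfl, fun x y _ hne => if_neg hne⟩
  exact congrArg Quotient.out (Quotient.sound (s := s) hxy)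

variable (A) in
theorem exists_isConstructed (p : ℕ) :
    ∃ a : ℕ → MeasurableAtom A → MeasurableAtom A → A, IsConstructed p a := by
  classical
  let a₀ : MeasurableAtom A → MeasurableAtom A → A := fun x y => if x = y then x else rect x y
  have h₀ : IsLevel p 0 a₀ := isLevel_zero (fun x => if_pos rfl) fun x y _ hne => if_neg hne
  choose next hnext using fun (k : ℕ) (s : {a : MeasurableAtom A → MeasurableAtom A → A //
    IsLevel p k a}) => s.2.exists_isStep
  -- The recursion carries the level properties along, since a step is only known to exist above a
  -- level that has them.
  let seq : ∀ k, {a : MeasurableAtom A → MeasurableAtom A → A // IsLevel p k a} := fun k =>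
    Nat.rec ⟨a₀, h₀⟩ (fun k s => ⟨next k s, (IsStep.isLevel s.2 (hnext k s)).1⟩) k
  exact ⟨fun k => (seq k).1, fun x => if_pos rfl, fun x y _ hne => if_neg hne,
    fun k => hnext k (seq k)⟩

end Levels

/-! ### Assembling the scaffold from the prime systems. -/

section Scaffold

theorem prime_of_mem_primesOf {n p : ℕ} (h : p ∈ primesOf n) : p.Prime := by
  unfold primesOf at h
  split_ifs at h
  · rw [Finset.mem_singleton.1 h]
    exact Nat.prime_two
  · exact Nat.prime_of_mem_primeFactors h

theorem primesOf_nonempty {n : ℕ} (h : n ≠ 0) : (primesOf n).Nonempty := by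
  unfold primesOf
  split_ifs with h1
  · exact Finset.singleton_nonempty 2
  · exact Nat.nonempty_primeFactors.2 (by lia)

theorem prod_primeFactors_pow {n : ℕ} (h : n ≠ 0) :
    ∏ p ∈ n.primeFactors, p ^ n.factorization p = n :=
  Nat.prod_factorization_pow_eq_self h

theorem prod_primesOf_pow {n : ℕ} (h : n ≠ 0) :
    ∏ p ∈ primesOf n, p ^ n.factorization p = n := by
  unfold primesOf
  split_ifs with h1
  · simp [h1]
  · exact prod_primeFactors_pow h

theorem primeFactors_subset_primesOf (n : ℕ) : n.primeFactors ⊆ primesOf n := by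
  unfold primesOf
  split_ifs with h1
  · simp [h1]
  · exact subset_rfl

variable {A : Type u} [RelationAlgebra A] {x y z : MeasurableAtom A}
  {a : ℕ → ℕ → MeasurableAtom A → MeasurableAtom A → A}

theorem IsPrimeSystem.antitone_le {p k l : ℕ} {a : ℕ → MeasurableAtom A → MeasurableAtom A → A}
    (h : IsPrimeSystem p a) (hkl : k ≤ l) (hs : Sim p l x y) : a l x y ≤ a k x y := by
  induction l, hkl using Nat.le_induction with
  | base => exact le_rfl
  | succ l _ ih => exact (h.antitone l x y hs).trans (ih (hs.mono (Nat.le_succ l)))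

theorem sim_factorization {n : ℕ} (hE : E x y) (hn : n ∣ m x y) (p : ℕ) :
    Sim p (n.factorization p) x y :=
  Or.inr ⟨hE, (Nat.ordProj_dvd n p).trans hn⟩

variable [∀ x : MeasurableAtom A, Finite (G x)]

theorem scaffoldElt_self (ha : ∀ p : ℕ, p.Prime → IsPrimeSystem p (a p))
    (x : MeasurableAtom A) :
    scaffoldElt a x x = x := by
  rw [scaffoldElt, Finset.inf_congr rfl (g := fun _ => (x : A))
    fun p hp => (ha p (prime_of_mem_primesOf hp)).diag _ x]
  exact Finset.inf_const (primesOf_nonempty (m_ne_zero x x)) _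

/-- Lowers the level from the exponent of `p` in `m x y` to its exponent in a divisor `n`. -/
theorem scaffoldElt_le (ha : ∀ p : ℕ, p.Prime → IsPrimeSystem p (a p)) (hE : E x y) {n p : ℕ}
    (hn : n ∣ m x y) (hp : p ∈ n.primeFactors) :
    scaffoldElt a x y ≤ a p (n.factorization p) x y := by
  have hm := m_ne_zero x y
  have h1 : p ∈ primesOf (m x y) :=
    primeFactors_subset_primesOf _ (Nat.primeFactors_mono hn hm hp)
  exact (Finset.inf_le h1).trans ((ha p (Nat.prime_of_mem_primeFactors hp)).antitone_le
    ((Nat.factorization_le_iff_dvd (ne_zero_of_dvd_ne_zero hm hn) hm).2 hn p)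
    (sim_factorization hE dvd_rfl p))

variable [∀ x : MeasurableAtom A, IsCyclic (G x)]

/-- Indices at different primes are coprime, so the meets stay blocks. The factor `rect x y` covers
the empty set of primes, where the bare infimum would be `⊤`. -/
theorem isBlock_inf_primes (ha : ∀ p : ℕ, p.Prime → IsPrimeSystem p (a p)) (hE : E x y)
    (hxy : x ≠ y) {n : ℕ} (hn : n ∣ m x y) (s : Finset ℕ) (hs : ∀ p ∈ s, p.Prime) :
    IsBlock x y (rect x y ⊓ s.inf fun p => a p (n.factorization p) x y) ∧
      index x (rect x y ⊓ s.inf fun p => a p (n.factorization p) x y) =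
        ∏ p ∈ s, p ^ n.factorization p := by
  induction s using Finset.induction_on with
  | empty =>
    rw [Finset.inf_empty, inf_top_eq, Finset.prod_empty]
    exact ⟨isBlock_rect hE, index_rect⟩
  | insert p s hps ih =>
    obtain ⟨h1, h2⟩ := ih fun q hq => hs q (Finset.mem_insert_of_mem hq)
    have hp := hs p (Finset.mem_insert_self p s)
    have hsim := sim_factorization hE hn p
    have h3 := isRegular_iff.1 ((ha p hp).regular _ x y hsim)
    have h4 := (ha p hp).index_eq _ x y hsim hxy
    have h5 := h3.inf_of_coprime h1 (by
      rw [h2, h4]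
      refine Nat.Coprime.prod_right fun q hq => Nat.Coprime.pow _ _ ?_
      rw [Nat.coprime_primes hp (hs q (Finset.mem_insert_of_mem hq))]
      exact fun h => hps (h ▸ hq))
    rwa [h2, h4, inf_left_comm, ← Finset.inf_insert (f := fun p => a p (n.factorization p) x y),
      ← Finset.prod_insert (f := fun p => p ^ n.factorization p) hps] at h5

theorem scaffoldElt_spec (ha : ∀ p : ℕ, p.Prime → IsPrimeSystem p (a p)) (hE : E x y) :
    IsBlock x y (scaffoldElt a x y) ∧ index x (scaffoldElt a x y) = m x y := by
  -- On the diagonal every level is `x` itself, whose index is `m x x` and not a power of `p`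
  -- prescribed by the level.
  by_cases hxy : x = y
  · subst hxy
    rw [scaffoldElt_self ha]
    exact ⟨isBlock_self, index_eq_m x.2.1 ident_le_rect⟩
  have hm := m_ne_zero x y
  have h := isBlock_inf_primes ha hE hxy dvd_rfl (primesOf (m x y))
    fun p hp => prime_of_mem_primesOf hp
  obtain ⟨p, hp⟩ := primesOf_nonempty hm
  have hle : scaffoldElt a x y ≤ rect x y := (Finset.inf_le hp).trans
    ((ha p (prime_of_mem_primesOf hp)).regular _ x y (sim_factorization hE dvd_rfl p)).1
  have h' := inf_eq_right.2 hle
  rw [scaffoldElt] at h' ⊢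
  rwa [prod_primesOf_pow hm, h'] at h

theorem scaffoldElt_conv (ha : ∀ p : ℕ, p.Prime → IsPrimeSystem p (a p)) (hE : E x y) :
    scaffoldElt a y x = (scaffoldElt a x y)˘ := by
  rw [scaffoldElt, scaffoldElt, finset_inf_conv, m_comm x y hE]
  exact Finset.inf_congr rfl fun p hp =>
    (ha p (prime_of_mem_primesOf hp)).conv_eq _ x y (sim_factorization hE dvd_rfl p)

theorem scaffoldElt_le_comp (ha : ∀ p : ℕ, p.Prime → IsPrimeSystem p (a p)) (hxy : E x y)
    (hyz : E y z) : scaffoldElt a x z ≤ scaffoldElt a x y ⨾ scaffoldElt a y z := by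
  obtain ⟨hd, hdi⟩ := scaffoldElt_spec ha hxy
  obtain ⟨he, hei⟩ := scaffoldElt_spec ha hyz
  obtain ⟨hf, -⟩ := scaffoldElt_spec ha (hxy.trans hyz)
  by_cases hxz : x = z
  · subst hxz
    rw [scaffoldElt_self ha, scaffoldElt_conv ha hxy]
    exact le_comp_conv_self hd.2.1 hd.1
  have hde := hd.comp he
  -- At the exponents of `n` all three pairs are related by `∼_k`, so `eq_comp` applies; at the full
  -- exponents of `m x y` or `m y z` this may fail.
  set n := index x (scaffoldElt a x y ⨾ scaffoldElt a y z) with hn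
  have hn1 : n ∣ m x y := hdi ▸ index_comp_dvd_left hd.1 he.1
  have hn2 : n ∣ m y z := hei ▸ index_comp_dvd_right hd.1 he.1
  have hn3 : n ∣ m x z := index_dvd_m hde.1
  obtain ⟨hc, hci⟩ := isBlock_inf_primes ha (hxy.trans hyz) hxz hn3 n.primeFactors
    fun p hp => Nat.prime_of_mem_primeFactors hp
  rw [prod_primeFactors_pow (ne_zero_of_dvd_ne_zero (m_ne_zero x y) hn1)] at hci
  have hle : scaffoldElt a x y ⨾ scaffoldElt a y z ≤
      rect x z ⊓ n.primeFactors.inf fun p => a p (n.factorization p) x z := by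
    refine le_inf hde.1 (Finset.le_inf fun p hp => ?_)
    rw [(ha p (Nat.prime_of_mem_primeFactors hp)).eq_comp _ x y z
      (sim_factorization hxy hn1 p) (sim_factorization hyz hn2 p) hxz]
    exact comp_mono (scaffoldElt_le ha hxy hn1 hp) (scaffoldElt_le ha hyz hn2 hp)
  -- The block over the primes of `n` contains `a_xz` by descent of levels. It meets the product
  -- `a_xy ; a_yz` and has the same index `n`, so it lies below that product.
  refine (le_inf hf.1 (Finset.le_inf fun p hp => scaffoldElt_le ha (hxy.trans hyz) hn3 hp)).trans
    (hc.le_of_leftStab_le hde ?_ (leftStab_le_of_index_dvd (by rw [hci])))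
  rw [inf_eq_right.2 hle]
  exact hde.2.1

theorem isScaffold_scaffoldElt (ha : ∀ p : ℕ, p.Prime → IsPrimeSystem p (a p)) :
    IsScaffold (scaffoldElt a) where
  atom _ _ hE := (scaffoldElt_spec ha hE).1.isAtom_of_index (scaffoldElt_spec ha hE).2
  diag := scaffoldElt_self ha
  conv_eq _ _ := scaffoldElt_conv ha
  le_comp _ _ _ := scaffoldElt_le_comp ha

end Scaffold

end RelationAlgebra

theorem mainTheorem2 {A : Type u} [RelationAlgebra A]
    (hA : RelationAlgebra.IsMeasurable A)
    (hG : ∀ x : RelationAlgebra.MeasurableAtom A,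
      Finite (RelationAlgebra.G x) ∧ IsCyclic (RelationAlgebra.G x)) :
    -- `H_xy` is well defined: atoms exist below `x ; 1 ; y`, all with the same left stabilizer
    (∀ x y : RelationAlgebra.MeasurableAtom A, RelationAlgebra.E x y →
      (∃ d : A, IsAtom d ∧ d ≤ RelationAlgebra.rect x y) ∧
      ∀ d : A, IsAtom d → d ≤ RelationAlgebra.rect x y →
        RelationAlgebra.leftStab x d = RelationAlgebra.H x y) ∧
    -- for every prime the construction can be carried out and yields the six properties
    (∀ p : ℕ, p.Prime →
      (∃ a : ℕ → RelationAlgebra.MeasurableAtom A → RelationAlgebra.MeasurableAtom A → A,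
        RelationAlgebra.IsConstructed p a) ∧
      ∀ a : ℕ → RelationAlgebra.MeasurableAtom A → RelationAlgebra.MeasurableAtom A → A,
        RelationAlgebra.IsConstructed p a → RelationAlgebra.IsPrimeSystem p a) ∧
    -- the products form a scaffold of atoms of index `m_xy`
    (∀ a : ℕ → ℕ → RelationAlgebra.MeasurableAtom A → RelationAlgebra.MeasurableAtom A → A,
      (∀ p : ℕ, p.Prime → RelationAlgebra.IsPrimeSystem p (a p)) →
      (∀ x y : RelationAlgebra.MeasurableAtom A, RelationAlgebra.E x y →
        IsAtom (RelationAlgebra.scaffoldElt a x y) ∧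
        RelationAlgebra.IsRegular x y (RelationAlgebra.scaffoldElt a x y) ∧
        RelationAlgebra.index x (RelationAlgebra.scaffoldElt a x y) = RelationAlgebra.m x y) ∧
      RelationAlgebra.IsScaffold (RelationAlgebra.scaffoldElt a)) := by
  have : ∀ x : RelationAlgebra.MeasurableAtom A, Finite (RelationAlgebra.G x) :=
    fun x => (hG x).1
  have : ∀ x : RelationAlgebra.MeasurableAtom A, IsCyclic (RelationAlgebra.G x) :=
    fun x => (hG x).2
  refine ⟨fun x y hE => ⟨RelationAlgebra.exists_atom_le hE le_rfl, fun d hd hl =>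
      RelationAlgebra.leftStab_eq_H hd hl⟩,
    fun p _ => ⟨RelationAlgebra.exists_isConstructed A p, fun a ha => ha.isPrimeSystem⟩,
    fun a ha => ⟨fun x y hE => ?_, RelationAlgebra.isScaffold_scaffoldElt ha⟩⟩
  obtain ⟨h1, h2⟩ := RelationAlgebra.scaffoldElt_spec ha hE
  exact ⟨h1.isAtom_of_index h2, RelationAlgebra.isRegular_iff.2 h1, h2⟩
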